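/- Let $M$ be an $n\times n$ partial matrix: a symmetric matrix some of whose entries are unspecified (with $m_{ij}$ specified if and only if $m_{ji}$ is), whose specified entries are nonnegative reals and whose diagonal entries are specified and equal to $0$. For $d\in\mathbb N$, the pair $(M,d)$ is a yes-instance of $d$-EDMC if the unspecified entries of $M$ can be filled in so that there are (not necessarily distinct) points $p_1,\dots,p_n\in\mathbb R^d$ for which the $(i,j)$ entry of the completed matrix is $\|p_i-p_j\|_2^2$ for all $i,j$; otherwise it is a no-instance. Two instances are equivalent if both are yes-instances or both are no-instances. Theorem. There is a deterministic algorithm on the real RAM (arithmetic and comparison of real numbers and memory access take unit time, integer addition, subtraction and comparison take unit time, integer multiplication takes time linear in the bit lengths of its factors, and there is no rounding of reals to integers) whose running time is bounded by a polynomial in $n$ and which, given an instance $(M,d)$ such that every row of the $n\times n$ partial matrix $M$ has at most $\Delta$ unspecified entries, either correctly decides whether $(M,d)$ is a yes-instance, or outputs an instance $(M',d)$ equivalent to $(M,d)$ such that $M'$ is a principal $n'\times n'$ submatrix of $M$ with $n'\le (d+1)(\Delta+1)^2$. -/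

import Mathlib

/-! ### Partial matrices and the Euclidean distance matrix completion problem -/

/-- A symmetric hollow `n × n` matrix over the nonnegative reals with some unspecified entries
(`none`). The diagonal is specified and equal to `0`. -/
structure PartialMatrix (n : ℕ) where
  entry : Fin n → Fin n → Option ℝ
  nonneg : ∀ i j v, entry i j = some v → 0 ≤ v
  symm : ∀ i j, entry i j = entry j i
  diag : ∀ i, entry i i = some 0

/-- The number of unspecified entries in row `i`. -/
def PartialMatrix.unspecified {n : ℕ} (M : PartialMatrix n) (i : Fin n) : ℕ :=
  (Finset.univ.filter fun j => (M.entry i j).isNone).card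

/-- The principal submatrix of `M` on the rows and columns `f 0 < f 1 < ⋯ < f (m - 1)`. -/
def PartialMatrix.principal {m n : ℕ} (M : PartialMatrix n) (f : Fin m ↪o Fin n) :
    PartialMatrix m where
  entry i j := M.entry (f i) (f j)
  nonneg i j := M.nonneg (f i) (f j)
  symm i j := M.symm (f i) (f j)
  diag i := M.diag (f i)

/-- `D` is a Euclidean distance matrix in `ℝ^d`; the entries are squared distances, and the
points need not be distinct. -/
def IsEDM {n : ℕ} (d : ℕ) (D : Matrix (Fin n) (Fin n) ℝ) : Prop :=
  ∃ p : Fin n → EuclideanSpace ℝ (Fin d), ∀ i j, D i j = ‖p i - p j‖ ^ 2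

/-- `(M, d)` is a yes-instance of `d`-EDMC: the unspecified entries of `M` can be filled in so
that the result is a Euclidean distance matrix in `ℝ^d`. -/
def PartialMatrix.IsYes {n : ℕ} (M : PartialMatrix n) (d : ℕ) : Prop :=
  ∃ D : Matrix (Fin n) (Fin n) ℝ,
    IsEDM d D ∧ ∀ i j (v : ℝ), M.entry i j = some v → D i j = v

/-! ### The real RAM

A structured programming language over a random access memory with natural-number cells and
real cells.  A program is a fixed finite text, so that it uses finitely many registers and
finitely many (unbounded) arrays.  Array indices are computed natural numbers.  Operations cost
one unit, except that the multiplication of natural numbers is charged the bit lengths of its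
factors, so that long multiplications are not free.  Reals can be added, subtracted, multiplied,
divided and compared; they cannot be rounded, and no real constants other than (the casts of)
natural numbers can be written in a program. -/

namespace RealRAM

/-- A memory state. -/
structure State where
  natReg : ℕ → ℕ
  realReg : ℕ → ℝ
  /-- `natArr a k` is cell `k` of the natural-number array `a`. -/
  natArr : ℕ → ℕ → ℕ
  /-- `realArr a k` is cell `k` of the real array `a`. -/
  realArr : ℕ → ℕ → ℝ

/-- Expressions for natural numbers. -/
inductive NExp
  | const (k : ℕ)
  | reg (x : ℕ)
  | read (a : ℕ) (index : NExp)
  | add (e f : NExp)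
  | sub (e f : NExp)
  | mul (e f : NExp)

/-- The value of an expression; subtraction is truncated at `0`. -/
def NExp.eval (σ : State) : NExp → ℕ
  | const k => k
  | reg x => σ.natReg x
  | read a e => σ.natArr a (e.eval σ)
  | add e f => e.eval σ + f.eval σ
  | sub e f => e.eval σ - f.eval σ
  | mul e f => e.eval σ * f.eval σ

/-- The cost of evaluating an expression; `Nat.size` is the length in binary. -/
def NExp.cost (σ : State) : NExp → ℕ
  | const _ => 1
  | reg _ => 1
  | read _ e => e.cost σ + 1
  | add e f => e.cost σ + f.cost σ + 1
  | sub e f => e.cost σ + f.cost σ + 1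
  | mul e f => e.cost σ + f.cost σ + (e.eval σ).size + (f.eval σ).size + 1

/-- Expressions for real numbers. -/
inductive RExp
  | cast (e : NExp)
  | reg (x : ℕ)
  | read (a : ℕ) (index : NExp)
  | add (u v : RExp)
  | sub (u v : RExp)
  | mul (u v : RExp)
  | div (u v : RExp)

/-- The value of an expression; division by `0` returns `0`. -/
noncomputable def RExp.eval (σ : State) : RExp → ℝ
  | cast e => (e.eval σ : ℝ)
  | reg x => σ.realReg x
  | read a e => σ.realArr a (e.eval σ)
  | add u v => u.eval σ + v.eval σ
  | sub u v => u.eval σ - v.eval σ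
  | mul u v => u.eval σ * v.eval σ
  | div u v => u.eval σ / v.eval σ

/-- The cost of evaluating an expression. -/
def RExp.cost (σ : State) : RExp → ℕ
  | cast e => e.cost σ + 1
  | reg _ => 1
  | read _ e => e.cost σ + 1
  | add u v => u.cost σ + v.cost σ + 1
  | sub u v => u.cost σ + v.cost σ + 1
  | mul u v => u.cost σ + v.cost σ + 1
  | div u v => u.cost σ + v.cost σ + 1

/-- Branching conditions. -/
inductive Test
  | natLe (e f : NExp)
  | realLe (u v : RExp)
  | not (b : Test)
  | and (b c : Test)

def Test.Holds (σ : State) : Test → Prop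
  | natLe e f => e.eval σ ≤ f.eval σ
  | realLe u v => u.eval σ ≤ v.eval σ
  | not b => ¬ b.Holds σ
  | and b c => b.Holds σ ∧ c.Holds σ

def Test.cost (σ : State) : Test → ℕ
  | natLe e f => e.cost σ + f.cost σ + 1
  | realLe u v => u.cost σ + v.cost σ + 1
  | not b => b.cost σ + 1
  | and b c => b.cost σ + c.cost σ + 1

/-- Programs. -/
inductive Prog
  | skip
  | setNat (x : ℕ) (e : NExp)
  | setReal (x : ℕ) (u : RExp)
  | writeNat (a : ℕ) (index e : NExp)
  | writeReal (a : ℕ) (index : NExp) (u : RExp)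
  | seq (P Q : Prog)
  | ite (b : Test) (P Q : Prog)
  | while (b : Test) (P : Prog)

def State.setNat (σ : State) (x v : ℕ) : State :=
  { σ with natReg := Function.update σ.natReg x v }

noncomputable def State.setReal (σ : State) (x : ℕ) (v : ℝ) : State :=
  { σ with realReg := Function.update σ.realReg x v }

def State.writeNat (σ : State) (a k v : ℕ) : State :=
  { σ with natArr := Function.update σ.natArr a (Function.update (σ.natArr a) k v) }

noncomputable def State.writeReal (σ : State) (a k : ℕ) (v : ℝ) : State :=
  { σ with realArr := Function.update σ.realArr a (Function.update (σ.realArr a) k v) }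

/-- `Exec P σ t τ`: started in the state `σ`, the program `P` halts after exactly `t` time units
in the state `τ`. -/
inductive Exec : Prog → State → ℕ → State → Prop
  | skip (σ : State) : Exec .skip σ 1 σ
  | setNat (σ : State) (x : ℕ) (e : NExp) :
      Exec (.setNat x e) σ (e.cost σ + 1) (σ.setNat x (e.eval σ))
  | setReal (σ : State) (x : ℕ) (u : RExp) :
      Exec (.setReal x u) σ (u.cost σ + 1) (σ.setReal x (u.eval σ))
  | writeNat (σ : State) (a : ℕ) (k e : NExp) :
      Exec (.writeNat a k e) σ (k.cost σ + e.cost σ + 1) (σ.writeNat a (k.eval σ) (e.eval σ))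
  | writeReal (σ : State) (a : ℕ) (k : NExp) (u : RExp) :
      Exec (.writeReal a k u) σ (k.cost σ + u.cost σ + 1) (σ.writeReal a (k.eval σ) (u.eval σ))
  | seq {P Q : Prog} {σ τ υ : State} {s t : ℕ} :
      Exec P σ s τ → Exec Q τ t υ → Exec (.seq P Q) σ (s + t) υ
  | iteTrue {b : Test} {P Q : Prog} {σ τ : State} {t : ℕ} :
      b.Holds σ → Exec P σ t τ → Exec (.ite b P Q) σ (b.cost σ + t + 1) τ
  | iteFalse {b : Test} {P Q : Prog} {σ τ : State} {t : ℕ} :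
      ¬ b.Holds σ → Exec Q σ t τ → Exec (.ite b P Q) σ (b.cost σ + t + 1) τ
  | whileTrue {b : Test} {P : Prog} {σ τ υ : State} {s t : ℕ} :
      b.Holds σ → Exec P σ s τ → Exec (.while b P) τ t υ →
        Exec (.while b P) σ (b.cost σ + s + t + 1) υ
  | whileFalse {b : Test} {P : Prog} {σ : State} :
      ¬ b.Holds σ → Exec (.while b P) σ (b.cost σ + 1) σ

/-- The instance `(M, d)` is stored in block `b` of the memory: the size `n` and the dimension
`d` in two registers, and, in row-major order, the pattern of specified entries (`1` for
specified, `0` for unspecified) in the natural-number array `b` and the values of the specified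
entries in the real array `b`. Nothing is required of any other part of the memory. -/
def State.Stores (σ : State) (b : ℕ) {n : ℕ} (M : PartialMatrix n) (d : ℕ) : Prop :=
  σ.natReg (2 * b) = n ∧ σ.natReg (2 * b + 1) = d ∧
    ∀ i j : Fin n,
      σ.natArr b (i * n + j) = (if (M.entry i j).isSome then 1 else 0) ∧
      ∀ v : ℝ, M.entry i j = some v → σ.realArr b (i * n + j) = v

/-- The register in which a program leaves its verdict: `0` for "no", `1` for "yes", and `2` for
"see the output instance". -/
def verdict (σ : State) : ℕ := σ.natReg 4

end RealRAM

/-!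
Let `K` be one more than the maximal number of unspecified entries of a row, and distribute the
vertices greedily over `K` *bases*: a vertex with an unspecified entry in the column of an earlier
basis element is set aside, and any other vertex joins the first basis whose affine span does not
contain it. The latter is decided by Gaussian elimination on the squared distances. A vertex that
depends on all bases is discarded. In `ℝ^d` a basis has at most `d + 1` elements, and each of them
causes at most `K - 1` vertices to be set aside, so that at most `(d + 1) K ^ 2` vertices remain.

A discarded vertex `x` can be restored. Its position is determined by each basis, and for every
vertex `y` one of the `K` bases has no unspecified entry in the row of `y`, so that this basis also
determines the distance between `x` and `y`. The algorithm compares it with the specified entry, and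
a contradiction shows that the instance is a no-instance.
-/

namespace EDMC

open Finset Finsupp
open scoped RealInnerProductSpace

/-! ### Elimination on squared distances -/

section Residual

variable {ι : Type*} {D : ι → ι → ℝ}

/-- For a list of pivots, the most recent one first, twice the Gram matrix of the components
orthogonal to the affine span of the pivots, computed from the squared distances `D` by Gaussian
elimination. -/
noncomputable def residual (D : ι → ι → ℝ) : List ι → ι → ι → ℝ
  | [], _, _ => 0
  | [b], x, y => D x b + D b y - D x y
  | b :: c :: bs, x, y =>
    residual D (c :: bs) x y -
      residual D (c :: bs) x b * residual D (c :: bs) b y / residual D (c :: bs) b b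

/-- No division by zero occurs in the elimination that computes `residual`. -/
def PivotsNonzero (D : ι → ι → ℝ) : List ι → Prop
  | [] => True
  | [_] => True
  | b :: c :: bs => residual D (c :: bs) b b ≠ 0 ∧ PivotsNonzero D (c :: bs)

/-- The weights of the affine combination of the pivots that is the orthogonal projection of `x`
to their affine span. -/
noncomputable def footWeights (D : ι → ι → ℝ) : List ι → ι → ι →₀ ℝ
  | [], _ => 0
  | [b], _ => single b 1
  | b :: c :: bs, x =>
    footWeights D (c :: bs) x + (residual D (c :: bs) x b / residual D (c :: bs) b b) •
      (single b 1 - footWeights D (c :: bs) b)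

theorem footWeights_mem_supported : ∀ (bs : List ι) (x : ι),
    footWeights D bs x ∈ supported ℝ ℝ {b | b ∈ bs}
  | [], _ => zero_mem _
  | [b], _ => single_mem_supported ℝ 1 (by simp)
  | b :: c :: bs, x => by
    have ih (z : ι) : footWeights D (c :: bs) z ∈ supported ℝ ℝ {e | e ∈ b :: c :: bs} :=
      supported_mono (fun _ => List.mem_cons_of_mem b) (footWeights_mem_supported (c :: bs) z)
    exact add_mem (ih x)
      (Submodule.smul_mem _ _ (sub_mem (single_mem_supported ℝ 1 (by simp)) (ih b)))

theorem linearCombination_one_footWeights : ∀ {bs : List ι}, bs ≠ [] → ∀ x,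
    linearCombination ℝ (fun _ => (1 : ℝ)) (footWeights D bs x) = 1
  | [], h, _ => absurd rfl h
  | [b], _, _ => by simp [footWeights]
  | b :: c :: bs, _, x => by
    have ih := linearCombination_one_footWeights (List.cons_ne_nil c bs)
    simp [footWeights, ih]

theorem residual_eq_footWeights : ∀ {bs : List ι}, bs ≠ [] → PivotsNonzero D bs →
    (∀ b ∈ bs, D b b = 0) → ∀ x y, ∀ b ∈ bs, residual D bs x y =
      (D x b - linearCombination ℝ (D · b) (footWeights D bs x)) -
        (D x y - linearCombination ℝ (D · y) (footWeights D bs x))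
  | [], h, _, _ => absurd rfl h
  | [b], _, _, hD => by
    intro x y a ha
    obtain rfl := List.mem_singleton.1 ha
    simp only [residual, footWeights, linearCombination_single, hD a ha, one_smul]
    ring
  | b :: c :: bs, _, hpiv, hD => by
    intro x y a ha
    have ih := residual_eq_footWeights (List.cons_ne_nil c bs) hpiv.2
      fun e he => hD e (List.mem_cons_of_mem b he)
    have old (y : ι) {e : ι} (he : e ∈ c :: bs) : residual D (b :: c :: bs) x y =
        (D x e - linearCombination ℝ (D · e) (footWeights D (b :: c :: bs) x)) -
          (D x y - linearCombination ℝ (D · y) (footWeights D (b :: c :: bs) x)) := by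
      simp only [footWeights, map_add, map_smul, map_sub, linearCombination_single,
        smul_eq_mul, one_mul]
      rw [residual, mul_div_right_comm, ih x y e he, ih b y e he]
      ring
    have new : residual D (b :: c :: bs) x b = 0 := by
      rw [residual, mul_div_assoc, div_self hpiv.1, mul_one, sub_self]
    rcases List.mem_cons.1 ha with rfl | ha
    · have hc := List.mem_cons_self (a := c) (l := bs)
      linarith [old y hc, old a hc]
    · exact old y ha

end Residual

section WeightedSums

variable {ι V : Type*} [NormedAddCommGroup V] [InnerProductSpace ℝ V] {w : ι →₀ ℝ}

theorem linearCombination_congr_of_mem_supported {s : Set ι} (hw : w ∈ supported ℝ ℝ s)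
    {f g : ι → ℝ} (h : ∀ c ∈ s, f c = g c) :
    linearCombination ℝ f w = linearCombination ℝ g w := by
  simp only [linearCombination_apply]
  exact Finsupp.sum_congr fun c hc => by rw [h c (hw hc)]

theorem linearCombination_add_const (hw : linearCombination ℝ (fun _ => (1 : ℝ)) w = 1)
    (f : ι → ℝ) (k : ℝ) :
    linearCombination ℝ (fun c => f c + k) w = linearCombination ℝ f w + k := by
  simp only [linearCombination_apply, Finsupp.sum, smul_eq_mul, mul_one] at hw ⊢
  simp only [mul_add, sum_add_distrib, ← Finset.sum_mul, hw, one_mul]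

theorem inner_linearCombination (v : V) (p : ι → V) (w : ι →₀ ℝ) :
    ⟪v, linearCombination ℝ p w⟫ = linearCombination ℝ (fun c => ⟪v, p c⟫) w :=
  apply_linearCombination ℝ (innerₛₗ ℝ v) p w

/-- The parallel axis theorem. -/
theorem linearCombination_norm_sub_sq (hw : linearCombination ℝ (fun _ => (1 : ℝ)) w = 1)
    (p : ι → V) (a b : V) :
    linearCombination ℝ (fun c => ‖p c - a‖ ^ 2) w - ‖linearCombination ℝ p w - a‖ ^ 2 =
      linearCombination ℝ (fun c => ‖p c - b‖ ^ 2) w - ‖linearCombination ℝ p w - b‖ ^ 2 := by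
  have affine (v : V) :
      ‖v - a‖ ^ 2 - ‖v - b‖ ^ 2 = ⟪(2 : ℝ) • (b - a), v⟫ + (‖a‖ ^ 2 - ‖b‖ ^ 2) := by
    rw [norm_sub_sq_real, norm_sub_sq_real, real_inner_smul_left, inner_sub_left,
      real_inner_comm v a, real_inner_comm v b]
    ring
  have h := linearCombination_add_const hw (fun c => ⟪(2 : ℝ) • (b - a), p c⟫) (‖a‖ ^ 2 - ‖b‖ ^ 2)
  rw [← inner_linearCombination, ← affine] at h
  simp only [← affine] at h
  have hsub : linearCombination ℝ (fun c => ‖p c - a‖ ^ 2 - ‖p c - b‖ ^ 2) w =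
      linearCombination ℝ (fun c => ‖p c - a‖ ^ 2) w -
        linearCombination ℝ (fun c => ‖p c - b‖ ^ 2) w := by
    simp only [linearCombination_apply, Finsupp.sum, smul_eq_mul, mul_sub, sum_sub_distrib]
  linarith

end WeightedSums

section Realizations

variable {ι V : Type*} {S : Set ι} {E : ι → ι → Prop} {D : ι → ι → ℝ} {bs : List ι}

/-- `D` is a symmetric matrix on `S` with zero diagonal whose specified entries are the `D i j`
with `E i j`. -/
structure IsPartialDist (S : Set ι) (E : ι → ι → Prop) (D : ι → ι → ℝ) : Prop where
  mem : ∀ {i j}, E i j → i ∈ S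
  refl : ∀ {i}, i ∈ S → E i i
  symm : ∀ {i j}, E i j → E j i
  self : ∀ {i}, i ∈ S → D i i = 0
  comm : ∀ {i j}, E i j → D i j = D j i

/-- A list of indices that the elimination of `residual` can use as pivots: all entries between
them are specified, and no pivot depends on the later ones in the list. -/
structure IsPivotSystem (E : ι → ι → Prop) (D : ι → ι → ℝ) (bs : List ι) : Prop where
  nonzero : PivotsNonzero D bs
  clique : ∀ b ∈ bs, ∀ c ∈ bs, E b c

theorem IsPivotSystem.of_cons {b : ι} (h : IsPivotSystem E D (b :: bs)) :
    IsPivotSystem E D bs where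
  nonzero := by
    cases bs with
    | nil => trivial
    | cons c bs => exact h.nonzero.2
  clique e he f hf := h.clique e (List.mem_cons_of_mem b he) f (List.mem_cons_of_mem b hf)

/-- The points `p` have the specified distances between the elements of `T`. -/
def Realizes [NormedAddCommGroup V] (E : ι → ι → Prop) (D : ι → ι → ℝ) (T : Set ι) (p : ι → V) :
    Prop :=
  ∀ i ∈ T, ∀ j ∈ T, E i j → D i j = ‖p i - p j‖ ^ 2

theorem Realizes.update [DecidableEq ι] {V : Type*} [NormedAddCommGroup V] {p : ι → V} {T : Set ι}
    (hp : Realizes E D T p) (hD : IsPartialDist S E D) {x : ι} (hx : x ∉ T) {z : V}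
    (hz : ∀ y ∈ T, E x y → D x y = ‖z - p y‖ ^ 2) :
    Realizes E D (insert x T) (Function.update p x z) := by
  have hne {y : ι} (hy : y ∈ T) : y ≠ x := fun h => hx (h ▸ hy)
  rintro i (rfl | hi) j (rfl | hj) hij
  · simp [hD.self (hD.mem hij)]
  · rw [Function.update_self, Function.update_of_ne (hne hj), hz j hj hij]
  · rw [Function.update_self, Function.update_of_ne (hne hi), norm_sub_rev,
      ← hz i hi (hD.symm hij), hD.comm hij]
  · rw [Function.update_of_ne (hne hi), Function.update_of_ne (hne hj), hp i hi j hj hij]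

variable [NormedAddCommGroup V] [InnerProductSpace ℝ V] {p : ι → V}

/-- The orthogonal projection of `x` to the affine span of the pivots, computed without reference
to a position of `x` itself. -/
noncomputable def footPoint (D : ι → ι → ℝ) (p : ι → V) (bs : List ι) (x : ι) : V :=
  linearCombination ℝ p (footWeights D bs x)

theorem linearCombination_footWeights_norm_sub_sq (hne : bs ≠ []) (D : ι → ι → ℝ) (p : ι → V)
    (x : ι) (q : V) : linearCombination ℝ (fun c => ‖p c - q‖ ^ 2) (footWeights D bs x) =
      ‖footPoint D p bs x - q‖ ^ 2 +
        linearCombination ℝ (fun c => ‖p c - footPoint D p bs x‖ ^ 2) (footWeights D bs x) := by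
  have parallel_axis := linearCombination_norm_sub_sq
    (linearCombination_one_footWeights (D := D) hne x) p q (footPoint D p bs x)
  have foot : linearCombination ℝ p (footWeights D bs x) = footPoint D p bs x := rfl
  rw [foot, sub_self (footPoint D p bs x), norm_zero] at parallel_axis
  linarith

namespace Realizes

theorem linearCombination_footWeights {T : Set ι} (hp : Realizes E D T p) (hne : bs ≠ [])
    (hT : ∀ b ∈ bs, b ∈ T) {y : ι} (hyT : y ∈ T) (hy : ∀ c ∈ bs, E c y) (x : ι) :
    linearCombination ℝ (D · y) (footWeights D bs x) = ‖footPoint D p bs x - p y‖ ^ 2 +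
      linearCombination ℝ (fun c => ‖p c - footPoint D p bs x‖ ^ 2) (footWeights D bs x) := by
  rw [linearCombination_congr_of_mem_supported (footWeights_mem_supported bs x)
    fun c hc => hp c (hT c hc) y hyT (hy c hc)]
  exact linearCombination_footWeights_norm_sub_sq hne D p x (p y)

theorem residual_eq_footPoint {T : Set ι} (hp : Realizes E D T p) (hD : IsPartialDist S E D)
    (hbs : IsPivotSystem E D bs) (hT : ∀ b ∈ bs, b ∈ T) {x y b : ι} (hyT : y ∈ T)
    (hy : ∀ c ∈ bs, E c y) (hb : b ∈ bs) :
    residual D bs x y = (D x b - ‖footPoint D p bs x - p b‖ ^ 2) -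
      (D x y - ‖footPoint D p bs x - p y‖ ^ 2) := by
  have hne := List.ne_nil_of_mem hb
  rw [residual_eq_footWeights hne hbs.nonzero (fun c hc => hD.self (hD.mem (hy c hc))) x y b hb,
    hp.linearCombination_footWeights hne hT (hT b hb) (fun c hc => hbs.clique c hc b hb),
    hp.linearCombination_footWeights hne hT hyT hy]
  ring

theorem residual_eq_inner (hp : Realizes E D Set.univ p) (hD : IsPartialDist S E D)
    (hbs : IsPivotSystem E D bs) {x y b : ι} (hx : ∀ c ∈ bs, E c x) (hy : ∀ c ∈ bs, E c y)
    (hxy : E x y) (hb : b ∈ bs) :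
    residual D bs x y = 2 * ⟪p x - footPoint D p bs x, p y - p b⟫ := by
  rw [hp.residual_eq_footPoint hD hbs (fun _ _ => trivial) trivial hy hb,
    hp x trivial b trivial (hD.symm (hx b hb)), hp x trivial y trivial hxy]
  simp only [norm_sub_sq_real, inner_sub_left, inner_sub_right]
  ring

theorem inner_sub_footPoint_pivots (hp : Realizes E D Set.univ p) (hD : IsPartialDist S E D)
    (hbs : IsPivotSystem E D bs) {x b c : ι} (hx : ∀ c ∈ bs, E c x) (hb : b ∈ bs) (hc : c ∈ bs) :
    ⟪p x - footPoint D p bs x, p c - p b⟫ = 0 := by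
  have hcx {e : ι} (he : e ∈ bs) := hp.residual_eq_inner hD hbs hx
    (fun f hf => hbs.clique f hf c hc) (hD.symm (hx c hc)) he
  have h := hcx hc
  rw [hcx hb, sub_self, inner_zero_right] at h
  linarith

theorem residual_self (hp : Realizes E D Set.univ p) (hD : IsPartialDist S E D)
    (hbs : IsPivotSystem E D bs) (hne : bs ≠ []) {x : ι} (hx : ∀ c ∈ bs, E c x) :
    residual D bs x x = 2 * ‖p x - footPoint D p bs x‖ ^ 2 := by
  obtain ⟨b, hb⟩ := List.exists_mem_of_ne_nil bs hne
  set r : V := p x - footPoint D p bs x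
  have inner_pivot : ∀ c ∈ bs, ⟪r, p c⟫ = 0 + ⟪r, p b⟫ := fun c hc => by
    linarith [inner_sub_right (𝕜 := ℝ) r (p c) (p b), hp.inner_sub_footPoint_pivots hD hbs hx hb hc]
  have foot : ⟪r, footPoint D p bs x⟫ = ⟪r, p b⟫ := by
    rw [footPoint, inner_linearCombination,
      linearCombination_congr_of_mem_supported (footWeights_mem_supported bs x) inner_pivot,
      linearCombination_add_const (linearCombination_one_footWeights hne x)]
    simp [linearCombination_apply]
  rw [hp.residual_eq_inner hD hbs hx hx (hD.refl (hD.mem (hD.symm (hx b hb)))) hb,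
    ← real_inner_self_eq_norm_sq, inner_sub_right r, ← foot, ← inner_sub_right r]

theorem residual_eq_zero (hp : Realizes E D Set.univ p) (hD : IsPartialDist S E D)
    (hbs : IsPivotSystem E D bs) (hne : bs ≠ []) {x y : ι} (hx : ∀ c ∈ bs, E c x)
    (hxx : residual D bs x x = 0) (hy : ∀ c ∈ bs, E c y) (hxy : E x y) :
    residual D bs x y = 0 := by
  obtain ⟨b, hb⟩ := List.exists_mem_of_ne_nil bs hne
  have hr : p x - footPoint D p bs x = 0 := by simpa [hp.residual_self hD hbs hne hx] using hxx
  rw [hp.residual_eq_inner hD hbs hx hy hxy hb, hr, inner_zero_left, mul_zero]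

theorem length_le [FiniteDimensional ℝ V] (hp : Realizes E D Set.univ p)
    (hD : IsPartialDist S E D) : ∀ {bs : List ι}, IsPivotSystem E D bs →
      bs.length ≤ Module.finrank ℝ (vectorSpan ℝ (p '' {b | b ∈ bs})) + 1
  | [], _ => by simp
  | [b], _ => by simp
  | b :: c :: bs, hbs => by
    have ih := hp.length_le hD hbs.of_cons
    have hb : ∀ e ∈ c :: bs, E e b := fun e he =>
      hbs.clique e (List.mem_cons_of_mem b he) b List.mem_cons_self
    have hc : c ∈ c :: bs := List.mem_cons_self
    have mono : vectorSpan ℝ (p '' {e | e ∈ c :: bs}) ≤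
        vectorSpan ℝ (p '' {e | e ∈ b :: c :: bs}) :=
      vectorSpan_mono ℝ (Set.image_mono fun _ => List.mem_cons_of_mem b)
    have new : p b - p c ∈ vectorSpan ℝ (p '' {e | e ∈ b :: c :: bs}) :=
      vsub_mem_vectorSpan ℝ ⟨b, List.mem_cons_self, rfl⟩ ⟨c, List.mem_cons_of_mem b hc, rfl⟩
    have orthogonal : vectorSpan ℝ (p '' {e | e ∈ c :: bs}) ≤
        (ℝ ∙ (p b - footPoint D p (c :: bs) b))ᗮ := by
      rw [vectorSpan_def, Submodule.span_le]
      rintro _ ⟨_, ⟨e, he, rfl⟩, _, ⟨f, hf, rfl⟩, rfl⟩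
      exact Submodule.mem_orthogonal_singleton_iff_inner_right.2
        (hp.inner_sub_footPoint_pivots hD hbs.of_cons hb hf he)
    have notMem : p b - p c ∉ vectorSpan ℝ (p '' {e | e ∈ c :: bs}) := fun h => by
      refine hbs.nonzero.1 ?_
      rw [hp.residual_eq_inner hD hbs.of_cons hb hb (hbs.clique b (by simp) b (by simp)) hc,
        Submodule.mem_orthogonal_singleton_iff_inner_right.1 (orthogonal h), mul_zero]
    have := Submodule.finrank_lt_finrank_of_lt (mono.lt_of_ne fun h => notMem (h ▸ new))
    simp only [List.length_cons] at ih ⊢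
    omega

section Dependent

variable {T : Set ι} (hp : Realizes E D T p) (hD : IsPartialDist S E D)
  (hbs : IsPivotSystem E D bs) (hne : bs ≠ []) (hT : ∀ b ∈ bs, b ∈ T) {x : ι}
  (hx : ∀ b ∈ bs, E b x) (hxx : residual D bs x x = 0)

include hp hD hbs hne hT hx hxx

/-- The left-hand side is the weighted mean of the prescribed squared distances of `x` to the
pivots, the right-hand side that of the squared distances of the foot point. -/
theorem linearCombination_footWeights_self :
    linearCombination ℝ (D · x) (footWeights D bs x) =
      linearCombination ℝ (fun c => ‖p c - footPoint D p bs x‖ ^ 2) (footWeights D bs x) := by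
  set ρ := linearCombination ℝ (D · x) (footWeights D bs x)
  set κ := linearCombination ℝ (fun c => ‖p c - footPoint D p bs x‖ ^ 2) (footWeights D bs x)
  have hxS : x ∈ S := by
    obtain ⟨b, hb⟩ := List.exists_mem_of_ne_nil bs hne
    exact hD.mem (hD.symm (hx b hb))
  have pivot : ∀ b ∈ bs, D b x = ‖p b - footPoint D p bs x‖ ^ 2 + (κ - ρ) := fun b hb => by
    have h := residual_eq_footWeights hne hbs.nonzero (fun c hc => hD.self (hD.mem (hx c hc)))
      x x b hb
    rw [hxx, hD.self hxS, ← hD.comm (hx b hb),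
      hp.linearCombination_footWeights hne hT (hT b hb) fun c hc => hbs.clique c hc b hb] at h
    rw [norm_sub_rev]
    linarith
  have : ρ = κ + (κ - ρ) :=
    (linearCombination_congr_of_mem_supported (footWeights_mem_supported bs x) pivot).trans
      (linearCombination_add_const (linearCombination_one_footWeights hne x) _ _)
  linarith

theorem eq_norm_footPoint_sub {y : ι} (hyT : y ∈ T) (hy : ∀ b ∈ bs, E b y)
    (hxy : residual D bs x y = 0) : D x y = ‖footPoint D p bs x - p y‖ ^ 2 := by
  obtain ⟨b, hb⟩ := List.exists_mem_of_ne_nil bs hne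
  have hDS : ∀ c ∈ bs, D c c = 0 := fun c hc => hD.self (hD.mem (hx c hc))
  have hxxb := residual_eq_footWeights hne hbs.nonzero hDS x x b hb
  have hxyb := residual_eq_footWeights hne hbs.nonzero hDS x y b hb
  rw [hxx, hp.linearCombination_footWeights_self hD hbs hne hT hx hxx,
    hD.self (hD.mem (hD.symm (hx b hb)))] at hxxb
  rw [hxy, hp.linearCombination_footWeights hne hT hyT hy] at hxyb
  linarith

theorem footPoint_eq {q : V} (hq : ∀ b ∈ bs, D b x = ‖p b - q‖ ^ 2) : footPoint D p bs x = q := by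
  have h := linearCombination_footWeights_norm_sub_sq hne D p x q
  rw [← linearCombination_congr_of_mem_supported (footWeights_mem_supported bs x) hq,
    hp.linearCombination_footWeights_self hD hbs hne hT hx hxx] at h
  simpa [sub_eq_zero] using h

end Dependent

end Realizes

end Realizations

/-! ### Greedy distribution over bases -/

section Labellings

/-- The elements below `v` with label `c`, in decreasing order. -/
def pivots (lab : ℕ → ℕ) (c v : ℕ) : List ℕ := ((List.range v).filter (lab · = c)).reverse

variable {E : ℕ → ℕ → Prop} {D : ℕ → ℕ → ℝ} {n d K : ℕ} {lab : ℕ → ℕ} {c v w : ℕ}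

theorem pivots_succ (lab : ℕ → ℕ) (c v : ℕ) :
    pivots lab c (v + 1) = if lab v = c then v :: pivots lab c v else pivots lab c v := by
  by_cases h : lab v = c <;> simp [pivots, List.range_succ, h]

theorem mem_pivots {u : ℕ} : u ∈ pivots lab c v ↔ u < v ∧ lab u = c := by
  simp [pivots]

theorem pivots_congr {lab' : ℕ → ℕ} (h : ∀ u < v, lab u = lab' u) :
    pivots lab c v = pivots lab' c v := by
  rw [pivots, pivots, List.filter_congr fun u hu => by rw [h u (List.mem_range.1 hu)]]

theorem length_pivots (lab : ℕ → ℕ) (c v : ℕ) :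
    (pivots lab c v).length = #{u ∈ range v | lab u = c} := by
  rw [pivots, List.length_reverse]; rfl

/-- The elements of basis `c` before `w` span the position of `w`. -/
def DependsOn (D : ℕ → ℕ → ℝ) (lab : ℕ → ℕ) (c w : ℕ) : Prop :=
  pivots lab c w ≠ [] ∧ residual D (pivots lab c w) w w = 0

/-- All entries between `w` and the earlier elements of the `K` bases are specified. -/
def Joined (E : ℕ → ℕ → Prop) (K : ℕ) (lab : ℕ → ℕ) (w : ℕ) : Prop :=
  ∀ u < w, lab u < K → E u w

/-- The label of `w` is the first of the bases `0, …, K - 1` that `w` does not depend on, or `K`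
if there is none. -/
structure FirstFit (D : ℕ → ℕ → ℝ) (K : ℕ) (lab : ℕ → ℕ) (w : ℕ) : Prop where
  le : lab w ≤ K
  dependsOn : ∀ c < lab w, DependsOn D lab c w
  not_dependsOn : lab w < K → ¬ DependsOn D lab (lab w) w

/-- The label of `w` is the one chosen by the greedy distribution over `K` bases; the label
`K + 1` is for elements with an unspecified entry in the column of an earlier basis element. -/
def Labelled (E : ℕ → ℕ → Prop) (D : ℕ → ℕ → ℝ) (K : ℕ) (lab : ℕ → ℕ) (w : ℕ) : Prop :=
  Joined E K lab w ∧ FirstFit D K lab w ∨ ¬ Joined E K lab w ∧ lab w = K + 1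

/-- The element `w` has an entry that contradicts its dependence on the basis `c`. -/
def Conflict (E : ℕ → ℕ → Prop) (D : ℕ → ℕ → ℝ) (lab : ℕ → ℕ) (c w : ℕ) : Prop :=
  ∃ y, E w y ∧ (∀ u ∈ pivots lab c w, E u y) ∧ residual D (pivots lab c w) w y ≠ 0

/-- The tests carried out when `w` is labelled: no dependence of `w` is contradicted, and `w` does
not make its basis larger than `d + 1`. -/
structure Consistent (E : ℕ → ℕ → Prop) (D : ℕ → ℕ → ℝ) (d K : ℕ) (lab : ℕ → ℕ) (w : ℕ) :
    Prop where
  not_conflict : lab w ≤ K → ∀ c < lab w, ¬ Conflict E D lab c w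
  length_le : lab w < K → (pivots lab (lab w) w).length ≤ d

theorem firstFit_iff : FirstFit D K lab w ↔ lab w ≤ K ∧ (∀ c < lab w, DependsOn D lab c w) ∧
    (lab w < K → ¬ DependsOn D lab (lab w) w) :=
  ⟨fun h => ⟨h.1, h.2, h.3⟩, fun h => ⟨h.1, h.2.1, h.2.2⟩⟩

theorem consistent_iff : Consistent E D d K lab w ↔
    (lab w ≤ K → ∀ c < lab w, ¬ Conflict E D lab c w) ∧
      (lab w < K → (pivots lab (lab w) w).length ≤ d) :=
  ⟨fun h => ⟨h.1, h.2⟩, fun h => ⟨h.1, h.2⟩⟩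

theorem Labelled.joined (h : Labelled E D K lab w) (hw : lab w ≤ K) : Joined E K lab w :=
  h.elim And.left fun h => by omega

theorem Labelled.firstFit (h : Labelled E D K lab w) (hw : lab w ≤ K) : FirstFit D K lab w :=
  h.elim And.right fun h => by omega

theorem Labelled.exists_not_specified (h : Labelled E D K lab w) (hw : K < lab w) :
    ∃ u < w, lab u < K ∧ ¬ E u w := by
  rcases h with h | h
  · exact absurd h.2.le (by omega)
  · simpa [Joined] using h.1

theorem specified_of_labelled (hD : IsPartialDist (Set.Iio n) E D)
    (hlab : ∀ w < n, Labelled E D K lab w) {a b : ℕ} (ha : a < n) (hb : b < n)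
    (ha' : lab a < K) (hb' : lab b < K) : E a b := by
  rcases lt_trichotomy a b with hab | rfl | hab
  · exact (hlab b hb).joined hb'.le a hab ha'
  · exact hD.refl ha
  · exact hD.symm ((hlab a ha).joined ha'.le b hab hb')

theorem isPivotSystem_pivots (hD : IsPartialDist (Set.Iio n) E D)
    (hlab : ∀ w < n, Labelled E D K lab w) (hc : c < K) (hv : v ≤ n) :
    IsPivotSystem E D (pivots lab c v) where
  nonzero := by
    induction v with
    | zero => trivial
    | succ v ih =>
      rw [pivots_succ]
      split_ifs with hl
      · have indep := ((hlab v hv).firstFit (by omega)).not_dependsOn (by omega)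
        rw [hl, DependsOn] at indep
        specialize ih (by omega)
        cases hp : pivots lab c v with
        | nil => trivial
        | cons b bs =>
          rw [hp] at indep ih
          exact ⟨fun h => indep ⟨List.cons_ne_nil b bs, h⟩, ih⟩
      · exact ih (by omega)
  clique a ha b hb := by
    rw [mem_pivots] at ha hb
    exact specified_of_labelled hD hlab (by omega) (by omega) (by omega) (by omega)

theorem consistent_of_realizes {V : Type*} [NormedAddCommGroup V] [InnerProductSpace ℝ V]
    [FiniteDimensional ℝ V] (hV : Module.finrank ℝ V ≤ d) {p : ℕ → V}
    (hp : Realizes E D Set.univ p) (hD : IsPartialDist (Set.Iio n) E D)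
    (hlab : ∀ w < n, Labelled E D K lab w) (hw : w < n) : Consistent E D d K lab w where
  not_conflict := by
    rintro hK c hc ⟨y, hwy, hcy, hres⟩
    obtain ⟨hne, hself⟩ := ((hlab w hw).firstFit hK).dependsOn c hc
    refine hres (hp.residual_eq_zero hD (isPivotSystem_pivots hD hlab (by omega) hw.le) hne
      (fun b hb => ?_) hself hcy hwy)
    rw [mem_pivots] at hb
    exact (hlab w hw).joined hK b hb.1 (by omega)
  length_le hK := by
    have h := (hp.length_le hD (isPivotSystem_pivots hD hlab hK hw)).trans
      (Nat.add_le_add_right ((Submodule.finrank_le _).trans hV) 1)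
    rwa [pivots_succ, if_pos rfl, List.length_cons, Nat.add_le_add_iff_right] at h

/-- Among `K` disjoint sets one avoids all of fewer than `K` elements. -/
theorem exists_pivots_specified [DecidableRel E] (hD : IsPartialDist (Set.Iio n) E D)
    (hK : #{u ∈ range n | ¬ E v u} < K) (hw : w ≤ n) : ∃ c < K, ∀ u ∈ pivots lab c w, E u v := by
  by_contra! hcon
  choose! f hf using hcon
  have hinj : Set.InjOn f (range K) := fun a ha b hb hab => by
    rw [coe_range, Set.mem_Iio] at ha hb
    rw [← (mem_pivots.1 (hf a ha).1).2, ← (mem_pivots.1 (hf b hb).1).2, hab]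
  refine (card_range K ▸ hK).not_ge (card_le_card_of_injOn f (fun c hc => ?_) hinj)
  obtain ⟨hmem, hE⟩ := hf c (by simpa using hc)
  have := (mem_pivots.1 hmem).1
  simpa using ⟨by omega, fun h => hE (hD.symm h)⟩

section Extension

variable {V : Type*} [NormedAddCommGroup V] [InnerProductSpace ℝ V] {p : ℕ → V}

variable [DecidableRel E] (hD : IsPartialDist (Set.Iio n) E D)
  (hlab : ∀ w < n, Labelled E D K lab w) (hcons : ∀ w < n, Consistent E D d K lab w)
  (hK : ∀ v < n, #{u ∈ range n | ¬ E v u} < K)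

include hD hlab hcons hK

theorem exists_realizes_insert {T : Set ℕ} (hp : Realizes E D T p) (hTn : T ⊆ Set.Iio n)
    (hT : ∀ u < n, lab u < K → u ∈ T) {x : ℕ} (hx : x < n) (hxT : x ∉ T) (hxK : lab x = K) :
    ∃ q : ℕ → V, Realizes E D (insert x T) q := by
  have hpiv (c : ℕ) (hc : c < K) := isPivotSystem_pivots hD hlab hc hx.le
  have pivot_mem {c : ℕ} (hc : c < K) : ∀ b ∈ pivots lab c x, b < x ∧ lab b < K ∧ b ∈ T :=
    fun b hb => by
      obtain ⟨hbx, rfl⟩ := mem_pivots.1 hb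
      exact ⟨hbx, hc, hT b (hbx.trans hx) hc⟩
  have pivot_joined {c : ℕ} (hc : c < K) : ∀ b ∈ pivots lab c x, E b x := fun b hb =>
    (hlab x hx).joined hxK.le b (pivot_mem hc b hb).1 (pivot_mem hc b hb).2.1
  have dep {c : ℕ} (hc : c < K) : DependsOn D lab c x :=
    ((hlab x hx).firstFit hxK.le).dependsOn c (hxK ▸ hc)
  set z : ℕ → V := fun c => footPoint D p (pivots lab c x) x
  have dist {c y : ℕ} (hc : c < K) (hy : y ∈ T) (hxy : E x y)
      (hcy : ∀ b ∈ pivots lab c x, E b y) : D x y = ‖z c - p y‖ ^ 2 := by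
    refine hp.eq_norm_footPoint_sub hD (hpiv c hc) (dep hc).1 (fun b hb => (pivot_mem hc b hb).2.2)
      (pivot_joined hc) (dep hc).2 hy hcy ?_
    by_contra hres
    exact (hcons x hx).not_conflict hxK.le c (hxK ▸ hc) ⟨y, hxy, hcy, hres⟩
  have hK0 : 0 < K := (Nat.zero_le _).trans_lt (hK x hx)
  have z_eq {c : ℕ} (hc : c < K) : z 0 = z c := by
    refine hp.footPoint_eq hD (hpiv 0 hK0) (dep hK0).1 (fun b hb => (pivot_mem hK0 b hb).2.2)
      (pivot_joined hK0) (dep hK0).2 fun b hb => ?_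
    obtain ⟨hbx, hbK, hbT⟩ := pivot_mem hK0 b hb
    rw [hD.comm (pivot_joined hK0 b hb), norm_sub_rev]
    refine dist hc hbT (hD.symm (pivot_joined hK0 b hb)) fun e he => ?_
    exact specified_of_labelled hD hlab ((pivot_mem hc e he).1.trans hx) (hbx.trans hx)
      (pivot_mem hc e he).2.1 hbK
  refine ⟨_, hp.update hD hxT (z := z 0) fun y hy hxy => ?_⟩
  obtain ⟨c, hc, hcy⟩ := exists_pivots_specified (lab := lab) hD (hK y (hTn hy)) hx.le
  rw [z_eq hc]
  exact dist hc hy hxy hcy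

theorem exists_realizes_univ (hp : Realizes E D {u | u < n ∧ lab u ≠ K} p) :
    ∃ q : ℕ → V, Realizes E D Set.univ q := by
  have extend (T : Finset ℕ) (hT : ∀ u ∈ T, u < n ∧ lab u = K) :
      ∃ q : ℕ → V, Realizes E D ({u | u < n ∧ lab u ≠ K} ∪ T) q := by
    induction T using Finset.induction_on with
    | empty => exact ⟨p, by simpa using hp⟩
    | insert x T hxT ih =>
      obtain ⟨q, hq⟩ := ih fun u hu => hT u (mem_insert_of_mem hu)
      obtain ⟨hxn, hxK⟩ := hT x (mem_insert_self x T)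
      rw [coe_insert, Set.union_insert]
      refine exists_realizes_insert hD hlab hcons hK hq ?_
        (fun u hu huK => Or.inl ⟨hu, huK.ne⟩) hxn ?_ hxK
      · rintro u (hu | hu)
        · exact hu.1
        · exact (hT u (mem_insert_of_mem hu)).1
      · rintro (hx | hx)
        exacts [hx.2 hxK, hxT hx]
  obtain ⟨q, hq⟩ := extend {u ∈ range n | lab u = K} (by simp)
  have hmem {i : ℕ} (hi : i < n) :
      i ∈ {u | u < n ∧ lab u ≠ K} ∪ (({u ∈ range n | lab u = K} : Finset ℕ) : Set ℕ) := by
    by_cases h : lab i = K <;> simp [hi, h]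
  exact ⟨q, fun i _ j _ hij => hq i (hmem (hD.mem hij)) j (hmem (hD.mem (hD.symm hij))) hij⟩

end Extension

theorem length_pivots_le (hcons : ∀ w < n, Consistent E D d K lab w) (hc : c < K) (hv : v ≤ n) :
    (pivots lab c v).length ≤ d + 1 := by
  induction v with
  | zero => simp [pivots]
  | succ v ih =>
    rw [pivots_succ]
    split_ifs with hl
    · subst hl
      exact Nat.succ_le_succ ((hcons v hv).length_le hc)
    · exact ih (by omega)

theorem card_bases_le (hcons : ∀ w < n, Consistent E D d K lab w) :
    #{u ∈ range n | lab u < K} ≤ (d + 1) * K := by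
  have hmaps : Set.MapsTo lab ({u ∈ range n | lab u < K} : Finset ℕ) (range K) := fun u hu => by
    simpa using (mem_filter.1 hu).2
  refine (card_eq_sum_card_fiberwise hmaps).trans_le
    ((sum_le_card_nsmul _ _ (d + 1) fun c hc => ?_).trans_eq (by simp [mul_comm]))
  calc #{u ∈ {u ∈ range n | lab u < K} | lab u = c} ≤ #{u ∈ range n | lab u = c} :=
        card_le_card (filter_subset_filter _ (filter_subset _ _))
    _ ≤ d + 1 := length_pivots lab c n ▸ length_pivots_le hcons (mem_range.1 hc) le_rfl

theorem card_kernel_le [DecidableRel E] (hlab : ∀ w < n, Labelled E D K lab w)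
    (hcons : ∀ w < n, Consistent E D d K lab w) (hK : ∀ v < n, #{u ∈ range n | ¬ E v u} < K) :
    #{u ∈ range n | lab u ≠ K} ≤ (d + 1) * K ^ 2 := by
  set A : Finset ℕ := {u ∈ range n | lab u < K}
  have cover : ({u ∈ range n | lab u ≠ K} : Finset ℕ) ⊆
      A.biUnion fun v => insert v {u ∈ range n | ¬ E v u} := fun w hw => by
    obtain ⟨hwn, hwK⟩ : w < n ∧ lab w ≠ K := by simpa using hw
    rw [mem_biUnion]
    rcases hwK.lt_or_gt with hlt | hgt
    · exact ⟨w, by simp [A, hwn, hlt], mem_insert_self _ _⟩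
    · obtain ⟨u, huw, hu, huE⟩ := (hlab w hwn).exists_not_specified hgt
      exact ⟨u, by simp [A, huw.trans hwn, hu], by simp [hwn, huE]⟩
  calc #{u ∈ range n | lab u ≠ K} ≤ #A * K :=
        (card_le_card cover).trans (card_biUnion_le_card_mul _ _ _ fun v hv =>
          (card_insert_le _ _).trans (hK v (mem_range.1 (mem_filter.1 hv).1)))
    _ ≤ (d + 1) * K * K := Nat.mul_le_mul_right K (card_bases_le hcons)
    _ = (d + 1) * K ^ 2 := by ring

section Congruence

variable {lab' : ℕ → ℕ}

theorem dependsOn_congr (h : ∀ u < w, lab u = lab' u) :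
    DependsOn D lab c w ↔ DependsOn D lab' c w := by
  rw [DependsOn, DependsOn, pivots_congr h]

theorem conflict_congr (h : ∀ u < w, lab u = lab' u) :
    Conflict E D lab c w ↔ Conflict E D lab' c w := by
  rw [Conflict, Conflict, pivots_congr h]

theorem joined_congr (h : ∀ u < w, lab u = lab' u) : Joined E K lab w ↔ Joined E K lab' w :=
  forall₂_congr fun u hu => by rw [h u hu]

theorem firstFit_congr (h : ∀ u ≤ w, lab u = lab' u) :
    FirstFit D K lab w ↔ FirstFit D K lab' w := by
  have hdep (c : ℕ) : DependsOn D lab c w ↔ DependsOn D lab' c w :=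
    dependsOn_congr fun u hu => h u hu.le
  simp only [firstFit_iff, h w le_rfl, hdep]

theorem labelled_congr (h : ∀ u ≤ w, lab u = lab' u) :
    Labelled E D K lab w ↔ Labelled E D K lab' w := by
  rw [Labelled, Labelled, joined_congr fun u hu => h u hu.le, firstFit_congr h, h w le_rfl]

theorem consistent_congr (h : ∀ u ≤ w, lab u = lab' u) :
    Consistent E D d K lab w ↔ Consistent E D d K lab' w := by
  have hconf (c : ℕ) : Conflict E D lab c w ↔ Conflict E D lab' c w :=
    conflict_congr fun u hu => h u hu.le
  simp only [consistent_iff, h w le_rfl, hconf, pivots_congr fun u hu => h u (le_of_lt hu)]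

end Congruence

section Search

variable {i : ℕ}

theorem FirstFit.succ_of_lt (h : FirstFit D i lab v) (hi : lab v < i) :
    FirstFit D (i + 1) lab v :=
  ⟨by omega, h.dependsOn, fun _ => h.not_dependsOn hi⟩

theorem FirstFit.succ_of_not_dependsOn (h : FirstFit D i lab v) (hi : lab v = i)
    (hdep : ¬ DependsOn D lab i v) : FirstFit D (i + 1) lab v :=
  ⟨by omega, h.dependsOn, fun _ => hi ▸ hdep⟩

theorem FirstFit.update_succ (h : FirstFit D i lab v) (hi : lab v = i)
    (hdep : DependsOn D lab i v) : FirstFit D (i + 1) (Function.update lab v (i + 1)) v := by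
  have hcongr : ∀ u < v, lab u = Function.update lab v (i + 1) u := fun u hu => by
    rw [Function.update_of_ne hu.ne]
  refine ⟨by simp, fun c hc => (dependsOn_congr hcongr).1 ?_, by simp⟩
  rw [Function.update_self, Nat.lt_succ_iff_lt_or_eq] at hc
  rcases hc with hc | rfl
  exacts [h.dependsOn c (hi ▸ hc), hdep]

theorem consistent_succ_of_lt (hi : lab v < i) :
    Consistent E D d (i + 1) lab v ↔ Consistent E D d i lab v := by
  simp only [consistent_iff, hi, hi.le, hi.trans (Nat.lt_succ_self i), (Nat.lt_succ_of_lt hi).le,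
    forall_const]

theorem consistent_succ_of_eq (hi : lab v = i) : Consistent E D d (i + 1) lab v ↔
    Consistent E D d i lab v ∧ (pivots lab i v).length ≤ d := by
  simp [consistent_iff, hi]

theorem consistent_update_succ (hi : lab v = i) :
    Consistent E D d (i + 1) (Function.update lab v (i + 1)) v ↔
      Consistent E D d i lab v ∧ ¬ Conflict E D lab i v := by
  have hcongr (c : ℕ) : Conflict E D (Function.update lab v (i + 1)) c v ↔ Conflict E D lab c v :=
    conflict_congr fun u hu => by rw [Function.update_of_ne hu.ne]
  simp only [consistent_iff, Function.update_self, hi, hcongr, le_refl, forall_const,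
    Nat.forall_lt_succ_right, lt_self_iff_false, false_imp_iff, and_true]

end Search

end Labellings

end EDMC

/-! ### Time-bounded program logic -/

namespace RealRAM

section State

variable (σ : State) (x a k v : ℕ)

@[simp] theorem State.setNat_natReg (y : ℕ) :
    (σ.setNat x v).natReg y = if y = x then v else σ.natReg y := by
  simp [State.setNat, Function.update_apply]

@[simp] theorem State.setNat_natArr : (σ.setNat x v).natArr = σ.natArr := rfl
@[simp] theorem State.setNat_realArr : (σ.setNat x v).realArr = σ.realArr := rfl

@[simp] theorem State.writeNat_natReg : (σ.writeNat a k v).natReg = σ.natReg := rfl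

@[simp] theorem State.writeNat_natArr (b j : ℕ) :
    (σ.writeNat a k v).natArr b j = if b = a ∧ j = k then v else σ.natArr b j := by
  rcases eq_or_ne b a with rfl | h <;> simp [State.writeNat, Function.update_apply, *]

theorem State.writeNat_natArr_self :
    (σ.writeNat a k v).natArr a = Function.update (σ.natArr a) k v := by
  simp [State.writeNat]

@[simp] theorem State.writeReal_realArr (t : ℝ) (b j : ℕ) :
    (σ.writeReal a k t).realArr b j = if b = a ∧ j = k then t else σ.realArr b j := by
  rcases eq_or_ne b a with rfl | h <;> simp [State.writeReal, Function.update_apply, *]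

end State

/-- Whether a program has an assignment to the natural-number register `x`. -/
def Prog.modReg (x : ℕ) : Prog → Bool
  | .setNat y _ => x == y
  | .seq P Q => P.modReg x || Q.modReg x
  | .ite _ P Q => P.modReg x || Q.modReg x
  | .while _ P => P.modReg x
  | _ => false

/-- Whether a program writes to the natural-number array `a`. -/
def Prog.modNatArr (a : ℕ) : Prog → Bool
  | .writeNat b _ _ => a == b
  | .seq P Q => P.modNatArr a || Q.modNatArr a
  | .ite _ P Q => P.modNatArr a || Q.modNatArr a
  | .while _ P => P.modNatArr a
  | _ => false

/-- Whether a program writes to the real array `a`. -/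
def Prog.modRealArr (a : ℕ) : Prog → Bool
  | .writeReal b _ _ => a == b
  | .seq P Q => P.modRealArr a || Q.modRealArr a
  | .ite _ P Q => P.modRealArr a || Q.modRealArr a
  | .while _ P => P.modRealArr a
  | _ => false

/-- The states `σ` and `τ` agree on all natural-number registers and all arrays that `P` does not
assign to. -/
structure Frame (P : Prog) (σ τ : State) : Prop where
  reg : ∀ {x}, P.modReg x = false → τ.natReg x = σ.natReg x
  natArr : ∀ {a}, P.modNatArr a = false → τ.natArr a = σ.natArr a
  realArr : ∀ {a}, P.modRealArr a = false → τ.realArr a = σ.realArr a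

section Frame

variable {P Q : Prog} {σ τ υ : State}

theorem Frame.refl (P : Prog) (σ : State) : Frame P σ σ :=
  ⟨fun _ => rfl, fun _ => rfl, fun _ => rfl⟩

theorem Frame.trans (h : Frame P σ τ) (h' : Frame P τ υ) : Frame P σ υ :=
  ⟨fun hx => (h'.reg hx).trans (h.reg hx), fun ha => (h'.natArr ha).trans (h.natArr ha),
    fun ha => (h'.realArr ha).trans (h.realArr ha)⟩

theorem Frame.seq_left (Q : Prog) (h : Frame P σ τ) : Frame (.seq P Q) σ τ :=
  ⟨fun hx => h.reg (Bool.or_eq_false_iff.1 hx).1,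
    fun ha => h.natArr (Bool.or_eq_false_iff.1 ha).1,
    fun ha => h.realArr (Bool.or_eq_false_iff.1 ha).1⟩

theorem Frame.seq_right (P : Prog) (h : Frame Q σ τ) : Frame (.seq P Q) σ τ :=
  ⟨fun hx => h.reg (Bool.or_eq_false_iff.1 hx).2,
    fun ha => h.natArr (Bool.or_eq_false_iff.1 ha).2,
    fun ha => h.realArr (Bool.or_eq_false_iff.1 ha).2⟩

theorem Frame.loop (b : Test) (h : Frame P σ τ) : Frame (.while b P) σ τ :=
  ⟨h.reg, h.natArr, h.realArr⟩

theorem Exec.frame {t : ℕ} (h : Exec P σ t τ) : Frame P σ τ := by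
  induction h with
  | skip σ => exact .refl _ _
  | setNat σ x e =>
    refine ⟨fun hy => ?_, fun _ => rfl, fun _ => rfl⟩
    simp only [Prog.modReg, beq_eq_false_iff_ne] at hy
    simp [hy]
  | setReal σ x u => exact ⟨fun _ => rfl, fun _ => rfl, fun _ => rfl⟩
  | writeNat σ a k e =>
    refine ⟨fun _ => rfl, fun hb => ?_, fun _ => rfl⟩
    simp only [Prog.modNatArr, beq_eq_false_iff_ne] at hb
    funext j
    simp [hb]
  | writeReal σ a k e =>
    refine ⟨fun _ => rfl, fun _ => rfl, fun hb => ?_⟩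
    simp only [Prog.modRealArr, beq_eq_false_iff_ne] at hb
    funext j
    simp [hb]
  | seq _ _ ih ih' => exact (ih.seq_left _).trans (ih'.seq_right _)
  | @iteTrue b P Q _ _ _ _ _ ih =>
    have h := ih.seq_left Q
    exact ⟨h.reg, h.natArr, h.realArr⟩
  | @iteFalse b P Q _ _ _ _ _ ih =>
    have h := ih.seq_right P
    exact ⟨h.reg, h.natArr, h.realArr⟩
  | whileTrue _ _ _ ih ih' => exact (ih.loop _).trans ih'
  | whileFalse _ => exact .refl _ _

end Frame

/-- Started in `σ`, the program `P` halts within `k` time units in a state that satisfies `Q`. -/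
def WP (P : Prog) (k : ℕ) (Q : State → Prop) (σ : State) : Prop :=
  ∃ t τ, Exec P σ t τ ∧ t ≤ k ∧ Q τ

namespace WP

variable {P P' : Prog} {k k' c : ℕ} {Q R : State → Prop} {σ : State}

theorem mono (h : WP P k Q σ) (hk : k ≤ k') (hQ : ∀ τ, Frame P σ τ → Q τ → R τ) :
    WP P k' R σ := by
  obtain ⟨t, τ, hexec, ht, hτ⟩ := h
  exact ⟨t, τ, hexec, ht.trans hk, hQ τ hexec.frame hτ⟩

theorem skip (hk : 1 ≤ k) (h : Q σ) : WP .skip k Q σ := ⟨1, σ, .skip σ, hk, h⟩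

theorem setNat {x : ℕ} {e : NExp} (hk : e.cost σ + 1 ≤ k) (h : Q (σ.setNat x (e.eval σ))) :
    WP (.setNat x e) k Q σ :=
  ⟨_, _, .setNat σ x e, hk, h⟩

theorem writeNat {a : ℕ} {i e : NExp} (hk : i.cost σ + e.cost σ + 1 ≤ k)
    (h : Q (σ.writeNat a (i.eval σ) (e.eval σ))) : WP (.writeNat a i e) k Q σ :=
  ⟨_, _, .writeNat σ a i e, hk, h⟩

theorem writeReal {a : ℕ} {i : NExp} {u : RExp} (hk : i.cost σ + u.cost σ + 1 ≤ k)
    (h : Q (σ.writeReal a (i.eval σ) (u.eval σ))) : WP (.writeReal a i u) k Q σ :=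
  ⟨_, _, .writeReal σ a i u, hk, h⟩

theorem seq (h : WP P k R σ) (h' : ∀ τ, Frame P σ τ → R τ → WP P' k' Q τ) :
    WP (.seq P P') (k + k') Q σ := by
  obtain ⟨t, τ, hexec, ht, hτ⟩ := h
  obtain ⟨t', υ, hexec', ht', hυ⟩ := h' τ hexec.frame hτ
  exact ⟨_, υ, .seq hexec hexec', Nat.add_le_add ht ht', hυ⟩

theorem ite {b : Test} (hc : b.cost σ + 1 ≤ c) (h : b.Holds σ → WP P k Q σ)
    (h' : ¬ b.Holds σ → WP P' k Q σ) : WP (.ite b P P') (c + k) Q σ := by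
  by_cases hb : b.Holds σ
  · obtain ⟨t, τ, hexec, ht, hτ⟩ := h hb
    exact ⟨_, τ, .iteTrue hb hexec, by omega, hτ⟩
  · obtain ⟨t, τ, hexec, ht, hτ⟩ := h' hb
    exact ⟨_, τ, .iteFalse hb hexec, by omega, hτ⟩

theorem loop {b : Test} {N : ℕ} (I : ℕ → State → Prop) (h0 : I 0 σ)
    (hb : ∀ j ≤ N, ∀ τ, Frame P σ τ → I j τ → (b.Holds τ ↔ j < N) ∧ b.cost τ + 1 ≤ c)
    (hstep : ∀ j < N, ∀ τ, Frame P σ τ → I j τ → WP P k (I (j + 1)) τ) :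
    WP (.while b P) (N * (c + k) + c) (I N) σ := by
  suffices key : ∀ r j, j + r = N → ∀ τ, Frame P σ τ → I j τ →
      WP (.while b P) (r * (c + k) + c) (I N) τ from key N 0 (Nat.zero_add N) σ (.refl P σ) h0
  intro r
  induction r with
  | zero =>
    rintro j rfl τ hF hI
    obtain ⟨hbτ, hc⟩ := hb j le_rfl τ hF hI
    exact ⟨_, τ, .whileFalse fun h => lt_irrefl _ (hbτ.1 h), by omega, hI⟩
  | succ r ih =>
    intro j hj τ hF hI
    obtain ⟨hbτ, hc⟩ := hb j (by omega) τ hF hI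
    obtain ⟨t, υ, hexec, ht, hυ⟩ := hstep j (by omega) τ hF hI
    obtain ⟨t', φ, hexec', ht', hφ⟩ := ih (j + 1) (by omega) υ (hF.trans hexec.frame) hυ
    exact ⟨_, φ, .whileTrue (hbτ.2 (by omega)) hexec hexec', by rw [Nat.succ_mul]; omega, hφ⟩

end WP

/-- Increment the register `x`. -/
def Prog.incr (x : ℕ) : Prog := .setNat x (.add (.reg x) (.const 1))

/-- Run `body` with register `x` running from `0` to the value of register `lim`, exclusively. -/
def Prog.forLt (x lim : ℕ) (body : Prog) : Prog :=
  .seq (.setNat x (.const 0)) (.while (.natLe (.add (.reg x) (.const 1)) (.reg lim))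
    (.seq body (.incr x)))

/-- A time bound for `N` iterations of a loop body that takes time `k`. -/
def loopCost (N k : ℕ) : ℕ := N * (k + 10) + 8

theorem loopCost_mono {N N' k k' : ℕ} (hN : N ≤ N') (hk : k ≤ k') :
    loopCost N k ≤ loopCost N' k' := by
  unfold loopCost
  gcongr

section ForLoop

variable {x lim : ℕ} {body : Prog} {σ τ : State}

theorem Frame.forLt (x lim : ℕ) (h : Frame body σ τ) : Frame (Prog.forLt x lim body) σ τ :=
  ((h.seq_left _).loop _).seq_right _

variable {k N : ℕ}

theorem WP.forLt (I : ℕ → State → Prop) (hN : σ.natReg lim = N) (hx : body.modReg x = false)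
    (hl : (Prog.forLt x lim body).modReg lim = false) (h0 : I 0 (σ.setNat x 0))
    (hstep : ∀ j < N, ∀ τ, Frame (Prog.forLt x lim body) σ τ → τ.natReg x = j → I j τ →
      WP body k (fun υ => I (j + 1) (υ.setNat x (j + 1))) τ) :
    WP (Prog.forLt x lim body) (loopCost N k) (I N) σ := by
  have hF {τ υ : State} (h : Frame (.setNat x (.const 0)) σ τ)
      (h' : Frame (.seq body (.incr x)) τ υ) : Frame (Prog.forLt x lim body) σ υ :=
    (h.seq_left _).trans ((h'.loop _).seq_right _)
  have loop (τ : State) (hτ : Frame (.setNat x (.const 0)) σ τ) (hI : τ.natReg x = 0 ∧ I 0 τ) :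
      WP (.while (.natLe (.add (.reg x) (.const 1)) (.reg lim)) (.seq body (.incr x)))
        (N * (6 + (k + 4)) + 6) (fun υ => υ.natReg x = N ∧ I N υ) τ := by
    refine WP.loop (fun j υ => υ.natReg x = j ∧ I j υ) hI (fun j _ υ hυ hIυ =>
      ⟨?_, by simp [Test.cost, NExp.cost]⟩) fun j hj υ hυ hIυ =>
        WP.seq (hstep j hj υ (hF hτ hυ) hIυ.1 hIυ.2) fun φ hφ hIφ => WP.setNat le_rfl ?_
    · simp only [Test.Holds, NExp.eval, hIυ.1, (hF hτ hυ).reg hl, hN, Nat.add_one_le_iff]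
    · simpa [NExp.eval, (hφ.reg hx).trans hIυ.1] using hIφ
  refine (WP.seq (WP.setNat le_rfl ⟨by simp [NExp.eval], h0⟩) loop).mono ?_ fun υ _ h => h.2
  rw [loopCost, show 6 + (k + 4) = k + 10 by ring, NExp.cost]
  omega

theorem WP.forLt_flag {f : ℕ} (p : ℕ → Prop) (hN : σ.natReg lim = N)
    (hx : body.modReg x = false) (hl : (Prog.forLt x lim body).modReg lim = false) (hf : f ≠ x)
    (hstep : ∀ j < N, ∀ τ, Frame (Prog.forLt x lim body) σ τ → τ.natReg x = j →
      WP body k (fun υ => υ.natReg f = 0 ↔ τ.natReg f = 0 ∧ p j) τ) :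
    WP (Prog.forLt x lim body) (loopCost N k)
      (fun τ => τ.natReg f = 0 ↔ σ.natReg f = 0 ∧ ∀ j < N, p j) σ := by
  refine WP.forLt (fun i τ => τ.natReg f = 0 ↔ σ.natReg f = 0 ∧ ∀ j < i, p j) hN hx hl
    (by simp [hf]) fun j hj τ hF hτ hI => (hstep j hj τ hF hτ).mono le_rfl fun υ _ hυ => ?_
  rw [State.setNat_natReg, if_neg hf, hυ, hI, and_assoc, Nat.forall_lt_succ_right]

end ForLoop

end RealRAM

namespace EDMC

open RealRAM Finset

/-! ### The algorithm -/

-- `State.Stores` and `RealRAM.verdict` prescribe the registers `0` to `4` and the arrays `0` and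
-- `1`.
namespace Reg

@[simp] abbrev size : ℕ := 0
@[simp] abbrev dim : ℕ := 1
@[simp] abbrev outSize : ℕ := 2
@[simp] abbrev outDim : ℕ := 3
@[simp] abbrev verdict : ℕ := 4
@[simp] abbrev bases : ℕ := 5
@[simp] abbrev vertex : ℕ := 6
@[simp] abbrev basis : ℕ := 7
@[simp] abbrev pivot : ℕ := 8
@[simp] abbrev row : ℕ := 9
@[simp] abbrev col : ℕ := 10
@[simp] abbrev count : ℕ := 11
@[simp] abbrev rank : ℕ := 12
@[simp] abbrev fail : ℕ := 13
@[simp] abbrev unjoined : ℕ := 14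

end Reg

namespace Arr

@[simp] abbrev pattern : ℕ := 0
@[simp] abbrev outPattern : ℕ := 1
@[simp] abbrev label : ℕ := 2
@[simp] abbrev kernel : ℕ := 3

end Arr

namespace RealArr

@[simp] abbrev values : ℕ := 0
@[simp] abbrev outValues : ℕ := 1
@[simp] abbrev gram : ℕ := 2
@[simp] abbrev oldGram : ℕ := 3

end RealArr

section MatrixLoops

/-- The index of an entry in row-major order; the arguments are registers. -/
def ix (lim a b : ℕ) : NExp := .add (.mul (.reg a) (.reg lim)) (.reg b)

variable {lim a b k N C : ℕ} {σ : State} {P : Prog}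

@[simp] theorem ix_eval (lim a b : ℕ) (σ : State) :
    (ix lim a b).eval σ = σ.natReg a * σ.natReg lim + σ.natReg b := rfl

theorem size_le_self (k : ℕ) : k.size ≤ k := Nat.size_le.2 Nat.lt_two_pow_self

theorem ix_cost_le (lim a b : ℕ) (σ : State) :
    (ix lim a b).cost σ ≤ σ.natReg a + σ.natReg lim + 5 := by
  have ha := size_le_self (σ.natReg a)
  have hlim := size_le_self (σ.natReg lim)
  simp only [ix, NExp.cost, NExp.eval]
  omega

theorem ix_inj {x y x' y' : ℕ} (hy : y < N) (hy' : y' < N) :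
    x * N + y = x' * N + y' ↔ x = x' ∧ y = y' := by
  refine ⟨fun h => ?_, fun h => by rw [h.1, h.2]⟩
  have hx : x = x' := by
    simpa [mul_comm _ N, Nat.mul_add_div (Nat.zero_lt_of_lt hy), Nat.div_eq_of_lt hy,
      Nat.div_eq_of_lt hy'] using congrArg (· / N) h
  exact ⟨hx, by subst hx; omega⟩

/-- Run `P` for all entries of a square matrix whose size is in the register `lim`. -/
def forEntries (lim : ℕ) (P : Prog) : Prog := .forLt Reg.row lim (.forLt Reg.col lim P)

theorem wp_forEntries {Done : ℕ → ℕ → State → Prop} (hN : σ.natReg lim = N)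
    (hrow : (Prog.forLt Reg.col lim P).modReg Reg.row = false)
    (hcol : P.modReg Reg.col = false) (hlim : (forEntries lim P).modReg lim = false)
    (hreg : ∀ x y τ z v, Done x y τ → Done x y (τ.setNat z v))
    (hstep : ∀ x < N, ∀ y < N, ∀ τ, Frame (forEntries lim P) σ τ → τ.natReg Reg.row = x →
      τ.natReg Reg.col = y → WP P k (fun υ => Done x y υ ∧
        ∀ x' < N, ∀ y' < N, Done x' y' τ → Done x' y' υ) τ) :
    WP (forEntries lim P) (loopCost N (loopCost N k))
      (fun τ => ∀ x < N, ∀ y < N, Done x y τ) σ := by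
  have hlim' : (Prog.forLt Reg.col lim P).modReg lim = false :=
    (Bool.or_eq_false_iff.1 (Bool.or_eq_false_iff.1 hlim).2).1
  refine WP.forLt (fun i τ => ∀ x < i, ∀ y < N, Done x y τ) hN hrow hlim (by simp)
    fun i hi τ hF hτ hI => ?_
  refine (WP.forLt (k := k) (fun j υ => (∀ x < i, ∀ y < N, Done x y υ) ∧ ∀ y < j, Done i y υ)
    ((hF.reg hlim).trans hN) hcol hlim' ⟨fun x hx y hy => hreg _ _ _ _ _ (hI x hx y hy), by simp⟩
      fun j hj υ hF' hυ hI' => ?_).mono le_rfl fun υ _ hυ x hx y hy => hreg _ _ _ _ _ ?_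
  · refine (hstep i hi j hj υ (hF.trans (hF'.forLt _ _)) ((hF'.reg hrow).trans hτ) hυ).mono le_rfl
      fun φ _ hφ => ⟨fun x hx y hy => hreg _ _ _ _ _ ?_, fun y hy => hreg _ _ _ _ _ ?_⟩
    · exact hφ.2 x (hx.trans hi) y hy (hI'.1 x hx y hy)
    · rcases Nat.lt_succ_iff_lt_or_eq.1 hy with hy | rfl
      · exact hφ.2 i hi y (hy.trans hj) (hI'.2 y hy)
      · exact hφ.1
  · rcases Nat.lt_succ_iff_lt_or_eq.1 hx with hx | rfl
    · exact hυ.1 x hx y hy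
    · exact hυ.2 y hy

/-- Fill a matrix in the natural-number array `a`. -/
def fillNat (a lim : ℕ) (u : NExp) : Prog :=
  forEntries lim (.writeNat a (ix lim Reg.row Reg.col) u)

/-- Fill a matrix in the real array `a`. -/
def fillReal (a lim : ℕ) (u : RExp) : Prog :=
  forEntries lim (.writeReal a (ix lim Reg.row Reg.col) u)

/-- A time bound for filling an `N × N` matrix if each entry takes time `C`. -/
def fillCost (N C : ℕ) : ℕ := loopCost N (loopCost N (2 * N + C + 6))

theorem wp_fillNat {u : NExp} (F : ℕ → ℕ → ℕ) (hN : σ.natReg lim = N)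
    (hlim : (fillNat a lim u).modReg lim = false)
    (hu : ∀ x < N, ∀ y < N, ∀ τ, Frame (fillNat a lim u) σ τ → τ.natReg Reg.row = x →
      τ.natReg Reg.col = y → u.eval τ = F x y ∧ u.cost τ ≤ C) :
    WP (fillNat a lim u) (fillCost N C)
      (fun τ => ∀ x < N, ∀ y < N, τ.natArr a (x * N + y) = F x y) σ := by
  refine wp_forEntries hN rfl rfl hlim (fun _ _ _ _ _ h => h) fun x hx y hy τ hF hrow hcol => ?_
  obtain ⟨heval, hcost⟩ := hu x hx y hy τ hF hrow hcol
  have hix := ix_cost_le lim Reg.row Reg.col τ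
  have hl := (hF.reg hlim).trans hN
  refine WP.writeNat (by omega) ?_
  simp only [State.writeNat_natArr, ix_eval, hrow, hcol, hl, heval, true_and, if_true]
  intro x' _ y' hy' h
  simp only [ix_inj hy' hy, h, ite_eq_right_iff]
  rintro ⟨rfl, rfl⟩
  rfl

theorem wp_fillReal {u : RExp} (F : ℕ → ℕ → ℝ) (hN : σ.natReg lim = N)
    (hlim : (fillReal a lim u).modReg lim = false)
    (hu : ∀ x < N, ∀ y < N, ∀ τ, Frame (fillReal a lim u) σ τ → τ.natReg Reg.row = x →
      τ.natReg Reg.col = y → u.eval τ = F x y ∧ u.cost τ ≤ C) :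
    WP (fillReal a lim u) (fillCost N C)
      (fun τ => ∀ x < N, ∀ y < N, τ.realArr a (x * N + y) = F x y) σ := by
  refine wp_forEntries hN rfl rfl hlim (fun _ _ _ _ _ h => h) fun x hx y hy τ hF hrow hcol => ?_
  obtain ⟨heval, hcost⟩ := hu x hx y hy τ hF hrow hcol
  have hix := ix_cost_le lim Reg.row Reg.col τ
  have hl := (hF.reg hlim).trans hN
  refine WP.writeReal (by omega) ?_
  simp only [State.writeReal_realArr, ix_eval, hrow, hcol, hl, heval, true_and, if_true]
  intro x' _ y' hy' h
  simp only [ix_inj hy' hy, h, ite_eq_right_iff]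
  rintro ⟨rfl, rfl⟩
  rfl

end MatrixLoops

section Input

/-- The entry `(i, j)` of the `n × n` pattern stored in row-major order in the array `e` is
specified. -/
abbrev Spec (n : ℕ) (e : ℕ → ℕ) (i j : ℕ) : Prop := i < n ∧ j < n ∧ e (i * n + j) ≠ 0

/-- The entry `(i, j)` of the `n × n` matrix stored in row-major order in the array `r`. -/
abbrev Val (n : ℕ) (r : ℕ → ℝ) (i j : ℕ) : ℝ := r (i * n + j)

/-- The input consists of the size `n`, the dimension `d`, the pattern `e` and the values `r`. -/
structure Input (n d : ℕ) (e : ℕ → ℕ) (r : ℕ → ℝ) (σ : State) : Prop where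
  size : σ.natReg Reg.size = n
  dim : σ.natReg Reg.dim = d
  pattern : σ.natArr Arr.pattern = e
  values : σ.realArr RealArr.values = r

/-- Whether a program assigns to a part of the memory that contains the input. -/
def modInput (P : Prog) : Bool :=
  P.modReg Reg.size || P.modReg Reg.dim || P.modNatArr Arr.pattern || P.modRealArr RealArr.values

variable {n d x y : ℕ} {e : ℕ → ℕ} {r : ℕ → ℝ} {σ τ : State} {P : Prog}

theorem Input.frame (h : Input n d e r σ) (hF : Frame P σ τ) (hP : modInput P = false) :
    Input n d e r τ := by
  simp only [modInput, Bool.or_eq_false_iff] at hP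
  obtain ⟨⟨⟨hsize, hdim⟩, hpattern⟩, hvalues⟩ := hP
  exact ⟨(hF.reg hsize).trans h.size, (hF.reg hdim).trans h.dim,
    (hF.natArr hpattern).trans h.pattern, (hF.realArr hvalues).trans h.values⟩

/-- The entry whose row and column are in the registers `a` and `b` is unspecified. -/
def unspecified (a b : ℕ) : Test := .natLe (.read Arr.pattern (ix Reg.size a b)) (.const 0)

variable {a b : ℕ}

theorem unspecified_holds (h : Input n d e r σ) (ha : σ.natReg a = x) (hx : x < n)
    (hb : σ.natReg b = y) (hy : y < n) : (unspecified a b).Holds σ ↔ ¬ Spec n e x y := by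
  have hsize := h.size
  have hpattern := h.pattern
  simp only [Reg.size, Arr.pattern] at hsize hpattern
  simp [unspecified, Test.Holds, NExp.eval, hsize, hpattern, ha, hb, hx, hy]

theorem unspecified_cost_le (h : Input n d e r σ) (ha : σ.natReg a = x) (hx : x < n) :
    (unspecified a b).cost σ ≤ 2 * n + 7 := by
  have hsize := h.size
  have hix := ix_cost_le Reg.size a b σ
  simp only [unspecified, Test.cost, NExp.cost]
  omega

/-- Put the number of unspecified entries of the row in `Reg.row`, plus one, into `Reg.count`. -/
def countRow : Prog :=
  .seq (.setNat Reg.count (.const 1)) (.forLt Reg.col Reg.size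
    (.ite (unspecified Reg.row Reg.col) (.incr Reg.count) .skip))

theorem wp_countRow (hσ : Input n d e r σ) (hx : σ.natReg Reg.row = x) (hxn : x < n) :
    WP countRow (2 + loopCost n (2 * n + 12))
      (fun τ => τ.natReg Reg.count = #{y ∈ range n | ¬ Spec n e x y} + 1) σ := by
  refine WP.seq (R := fun τ => τ.natReg Reg.count = 1) (WP.setNat le_rfl rfl) fun τ hF hτ => ?_
  have hin := hσ.frame hF rfl
  refine WP.forLt (fun j τ => τ.natReg Reg.count = #{y ∈ range j | ¬ Spec n e x y} + 1) hin.size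
    rfl rfl (by simpa using hτ) fun j hj υ hF' hυ hI => ?_
  have hin' := hin.frame hF' rfl
  have hrow : υ.natReg Reg.row = x := (hF'.reg rfl).trans ((hF.reg rfl).trans hx)
  have hcost := unspecified_cost_le (b := Reg.col) hin' hrow hxn
  have hspec := unspecified_holds hin' hrow hxn hυ hj
  refine WP.ite (c := 2 * n + 8) (k := 4) (by omega) (fun hb => WP.setNat le_rfl ?_)
    fun hb => WP.skip (by omega) ?_
  · rw [hspec] at hb
    simp [NExp.eval, range_add_one, filter_insert, hb, -not_and, hI]
  · rw [hspec] at hb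
    simp [range_add_one, filter_insert, hb, -not_and, hI]

/-- The number `K` of bases exceeds the maximal number of unspecified entries of a row by one. -/
structure NumBases (n : ℕ) (e : ℕ → ℕ) (K : ℕ) : Prop where
  lt : ∀ x < n, #{y ∈ range n | ¬ Spec n e x y} < K
  le : ∀ Δ, (∀ x < n, #{y ∈ range n | ¬ Spec n e x y} ≤ Δ) → K ≤ Δ + 1

/-- Put the number of bases into `Reg.bases`. -/
def maxRow : Prog :=
  .seq (.setNat Reg.bases (.const 1)) (.forLt Reg.row Reg.size
    (.seq countRow (.ite (.natLe (.reg Reg.count) (.reg Reg.bases)) .skip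
      (.setNat Reg.bases (.reg Reg.count)))))

def maxRowCost (n : ℕ) : ℕ := 2 + loopCost n (2 + loopCost n (2 * n + 12) + 6)

theorem wp_maxRow (hσ : Input n d e r σ) :
    WP maxRow (maxRowCost n) (fun τ => NumBases n e (τ.natReg Reg.bases)) σ := by
  refine WP.seq (R := fun τ => τ.natReg Reg.bases = 1) (WP.setNat le_rfl rfl) fun τ hF hτ => ?_
  have hin := hσ.frame hF rfl
  refine (WP.forLt (fun i τ =>
    (∀ x < i, #{y ∈ range n | ¬ Spec n e x y} < τ.natReg Reg.bases) ∧
      ∀ Δ, (∀ x < n, #{y ∈ range n | ¬ Spec n e x y} ≤ Δ) → τ.natReg Reg.bases ≤ Δ + 1)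
    hin.size rfl rfl (by simp_all) fun i hi υ hF' hυ hI => ?_).mono le_rfl fun _ _ h => ⟨h.1, h.2⟩
  have hin' := hin.frame hF' rfl
  refine WP.seq (wp_countRow hin' hυ hi) fun φ hF'' hφ => ?_
  rw [← hF''.reg (x := Reg.bases) rfl] at hI
  refine WP.ite (c := 4) (k := 2) le_rfl (fun hb => WP.skip (by omega) ?_)
    fun hb => WP.setNat le_rfl ?_ <;>
    simp only [Test.Holds, NExp.eval, hφ] at hb <;>
    simp only [State.setNat_natReg, NExp.eval, hφ, Nat.forall_lt_succ_right, if_true]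
  · exact ⟨⟨hI.1, hb⟩, hI.2⟩
  · exact ⟨⟨fun x hx => (hI.1 x hx).trans (not_le.1 hb), Nat.lt_succ_self _⟩,
      fun Δ hΔ => Nat.succ_le_succ (hΔ i hi)⟩

/-- Set `Reg.unjoined` if for an element below `Reg.vertex` that passes the test `b`, the entry in
the column given by register `y` is unspecified. The element to be tested is in `Reg.pivot`. -/
def joinTest (b : Test) (y : ℕ) : Prog :=
  .seq (.setNat Reg.unjoined (.const 0)) (.forLt Reg.pivot Reg.vertex
    (.ite (.and b (unspecified Reg.pivot y)) (.setNat Reg.unjoined (.const 1)) .skip))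

theorem wp_joinTest {test : Test} {v C : ℕ} {p : ℕ → Prop} (hσ : Input n d e r σ)
    (hv : σ.natReg Reg.vertex = v) (hvn : v < n) (hb : σ.natReg b = y) (hy : y < n)
    (hmod : (joinTest test b).modReg b = false)
    (htest : ∀ u < v, ∀ τ, Frame (joinTest test b) σ τ → τ.natReg Reg.pivot = u →
      (test.Holds τ ↔ p u) ∧ test.cost τ ≤ C) :
    WP (joinTest test b) (2 + loopCost n (C + 2 * n + 11))
      (fun τ => τ.natReg Reg.unjoined = 0 ↔ ∀ u < v, p u → Spec n e u y) σ := by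
  refine (WP.seq (k' := loopCost v (C + 2 * n + 11)) (R := fun τ => τ.natReg Reg.unjoined = 0)
    (WP.setNat le_rfl rfl) fun τ hF hτ => ?_).mono
      (Nat.add_le_add_left (loopCost_mono hvn.le le_rfl) 2) fun τ _ h => h
  refine (WP.forLt_flag (f := Reg.unjoined) (fun u => p u → Spec n e u y)
    ((hF.reg rfl).trans hv) rfl rfl (by decide) fun u hu υ hF' hυ => ?_).mono le_rfl
      fun υ _ hυ => hυ.trans (and_iff_right hτ)
  have hFυ := (hF.seq_left _).trans (hF'.seq_right _)
  have hin := hσ.frame hFυ rfl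
  obtain ⟨hholds, hcost⟩ := htest u hu υ hFυ hυ
  have hunspec := unspecified_holds hin hυ (hu.trans hvn) ((hFυ.reg hmod).trans hb) hy
  have hcost' := unspecified_cost_le (b := b) hin hυ (hu.trans hvn)
  refine WP.ite (c := C + 2 * n + 9) (k := 2) (by simp only [Test.cost]; omega)
    (fun hb => WP.setNat le_rfl ?_) fun hb => WP.skip (by omega) ?_ <;>
    rw [Test.Holds, hholds, hunspec] at hb
  · simp only [State.setNat_natReg, NExp.eval, if_true, one_ne_zero, false_iff]
    exact fun h => hb.2 (h.2 hb.1)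
  · exact (and_iff_left (by tauto)).symm

end Input

section Basis

/-- The memory contains the input, the element `v` to be labelled, the basis `c` to be tried, and
the labels. -/
structure AtBasis (n d : ℕ) (e : ℕ → ℕ) (r : ℕ → ℝ) (v c : ℕ) (lab : ℕ → ℕ) (σ : State) : Prop
    extends Input n d e r σ where
  vertex : σ.natReg Reg.vertex = v
  vertex_lt : v < n
  basis : σ.natReg Reg.basis = c
  label : σ.natArr Arr.label = lab

/-- Whether a program assigns to a part of the memory that is described by `AtBasis`. -/
def modBasis (P : Prog) : Bool :=
  modInput P || P.modReg Reg.vertex || P.modReg Reg.basis || P.modNatArr Arr.label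

variable {n d v c x y : ℕ} {e : ℕ → ℕ} {r : ℕ → ℝ} {lab : ℕ → ℕ} {σ τ : State} {P : Prog}

theorem AtBasis.frame (h : AtBasis n d e r v c lab σ) (hF : Frame P σ τ)
    (hP : modBasis P = false) : AtBasis n d e r v c lab τ := by
  simp only [modBasis, Bool.or_eq_false_iff] at hP
  obtain ⟨⟨⟨hinput, hvertex⟩, hbasis⟩, hlabel⟩ := hP
  exact ⟨h.toInput.frame hF hinput, (hF.reg hvertex).trans h.vertex, h.vertex_lt,
    (hF.reg hbasis).trans h.basis, (hF.natArr hlabel).trans h.label⟩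

/-- The element in `Reg.pivot` belongs to the basis in `Reg.basis`. -/
def sameLabel : Test :=
  .and (.natLe (.read Arr.label (.reg Reg.pivot)) (.reg Reg.basis))
    (.natLe (.reg Reg.basis) (.read Arr.label (.reg Reg.pivot)))

theorem sameLabel_holds (h : AtBasis n d e r v c lab σ) {u : ℕ} (hu : σ.natReg Reg.pivot = u) :
    sameLabel.Holds σ ↔ lab u = c := by
  have hc := h.basis
  have hlab := h.label
  simp only [sameLabel, Test.Holds, NExp.eval, hlab, hc, hu, le_antisymm_iff]

/-- The residuals with respect to a single pivot, which is in `Reg.pivot`. -/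
def initGram : Prog :=
  fillReal RealArr.gram Reg.size
    (.sub (.add (.read RealArr.values (ix Reg.size Reg.row Reg.pivot))
      (.read RealArr.values (ix Reg.size Reg.pivot Reg.col)))
        (.read RealArr.values (ix Reg.size Reg.row Reg.col)))

theorem wp_initGram {b : ℕ} (hσ : Input n d e r σ) (hb : σ.natReg Reg.pivot = b) (hbn : b < n) :
    WP initGram (fillCost n (6 * n + 20)) (fun τ => ∀ x < n, ∀ y < n,
      τ.realArr RealArr.gram (x * n + y) = residual (Val n r) [b] x y) σ := by
  refine wp_fillReal _ hσ.size rfl fun x hx y _ τ hF hrow hcol => ?_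
  have hin := hσ.frame hF rfl
  have hpivot : τ.natReg Reg.pivot = b := (hF.reg rfl).trans hb
  have hsize := hin.size
  have hvalues := hin.values
  have hix (a b : ℕ) := ix_cost_le Reg.size a b τ
  have hrow_pivot := hix Reg.row Reg.pivot
  have hpivot_col := hix Reg.pivot Reg.col
  have hrow_col := hix Reg.row Reg.col
  refine ⟨?_, by simp only [RExp.cost]; omega⟩
  simp only [RExp.eval, ix_eval, residual, hvalues, hsize, hpivot, hrow, hcol]

/-- Pivot on the element in `Reg.pivot`. -/
def pivotGram : Prog :=
  .seq (fillReal RealArr.oldGram Reg.size (.read RealArr.gram (ix Reg.size Reg.row Reg.col)))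
    (fillReal RealArr.gram Reg.size
      (.sub (.read RealArr.oldGram (ix Reg.size Reg.row Reg.col))
        (.div (.mul (.read RealArr.oldGram (ix Reg.size Reg.row Reg.pivot))
          (.read RealArr.oldGram (ix Reg.size Reg.pivot Reg.col)))
            (.read RealArr.oldGram (ix Reg.size Reg.pivot Reg.pivot)))))

def pivotGramCost (n : ℕ) : ℕ := fillCost n (2 * n + 6) + fillCost n (8 * n + 30)

theorem wp_pivotGram {b : ℕ} {G : ℕ → ℕ → ℝ} (hsize : σ.natReg Reg.size = n)
    (hb : σ.natReg Reg.pivot = b) (hbn : b < n)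
    (hG : ∀ x < n, ∀ y < n, σ.realArr RealArr.gram (x * n + y) = G x y) :
    WP pivotGram (pivotGramCost n) (fun τ => ∀ x < n, ∀ y < n,
      τ.realArr RealArr.gram (x * n + y) = G x y - G x b * G b y / G b b) σ := by
  refine WP.seq (R := fun τ => ∀ x < n, ∀ y < n, τ.realArr RealArr.oldGram (x * n + y) = G x y)
    (wp_fillReal _ hsize rfl fun x hx y hy τ hF hrow hcol => ?_) fun υ hFυ hυ => ?_
  · have hsize' : τ.natReg Reg.size = n := (hF.reg rfl).trans hsize
    have hrow_col := ix_cost_le Reg.size Reg.row Reg.col τ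
    refine ⟨?_, by simp only [RExp.cost]; omega⟩
    have hgram := hF.realArr (a := RealArr.gram) rfl
    simp only [RExp.eval, ix_eval, hsize', hrow, hcol, hgram, hG x hx y hy]
  · have hsize : υ.natReg Reg.size = n := (hFυ.reg rfl).trans hsize
    refine wp_fillReal _ hsize rfl fun x hx y hy τ hF hrow hcol => ?_
    have hsize' : τ.natReg Reg.size = n := (hF.reg rfl).trans hsize
    have hpivot : τ.natReg Reg.pivot = b := (hF.reg rfl).trans ((hFυ.reg rfl).trans hb)
    have hix (a b : ℕ) := ix_cost_le Reg.size a b τ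
    have hrow_col := hix Reg.row Reg.col
    have hrow_pivot := hix Reg.row Reg.pivot
    have hpivot_col := hix Reg.pivot Reg.col
    have hpivot_pivot := hix Reg.pivot Reg.pivot
    have hold := hF.realArr (a := RealArr.oldGram) rfl
    refine ⟨?_, by simp only [RExp.cost]; omega⟩
    simp only [RExp.eval, ix_eval, hsize', hpivot, hrow, hcol, hold, hυ x hx y hy,
      hυ x hx b hbn, hυ b hbn y hy, hυ b hbn b hbn]

/-- Compute the residuals with respect to the elements of the basis in `Reg.basis` below
`Reg.vertex`, and put the number of these elements into `Reg.rank`. -/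
def gram : Prog :=
  .seq (.setNat Reg.rank (.const 0)) (.forLt Reg.pivot Reg.vertex (.ite sameLabel
    (.seq (.ite (.natLe (.reg Reg.rank) (.const 0)) initGram pivotGram) (.incr Reg.rank)) .skip))

/-- The memory contains the residuals with respect to the pivots `bs`, and their number; with no
pivots, nothing is required of the array. -/
def HasGram (n : ℕ) (r : ℕ → ℝ) (bs : List ℕ) (σ : State) : Prop :=
  σ.natReg Reg.rank = bs.length ∧ (bs ≠ [] → ∀ x < n, ∀ y < n,
    σ.realArr RealArr.gram (x * n + y) = residual (Val n r) bs x y)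

def addPivotCost (n : ℕ) : ℕ := 4 + (fillCost n (6 * n + 20) + pivotGramCost n) + 4

theorem wp_addPivot {u : ℕ} {bs : List ℕ} (hσ : Input n d e r σ)
    (hu : σ.natReg Reg.pivot = u) (hun : u < n) (hgram : HasGram n r bs σ) :
    WP (.seq (.ite (.natLe (.reg Reg.rank) (.const 0)) initGram pivotGram) (.incr Reg.rank))
      (addPivotCost n) (HasGram n r (u :: bs)) σ := by
  refine WP.seq (R := fun τ => ∀ x < n, ∀ y < n, τ.realArr RealArr.gram (x * n + y) =
      residual (Val n r) (u :: bs) x y)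
    (WP.ite le_rfl (fun hb => ?_) fun hb => ?_) fun τ hF hτ => WP.setNat le_rfl ?_
  · simp only [Test.Holds, NExp.eval, hgram.1, nonpos_iff_eq_zero, List.length_eq_zero_iff] at hb
    rw [hb]
    exact (wp_initGram hσ hu hun).mono (by omega) fun _ _ h => h
  · simp only [Test.Holds, NExp.eval, hgram.1, nonpos_iff_eq_zero, List.length_eq_zero_iff] at hb
    obtain ⟨a, as, rfl⟩ := List.exists_cons_of_ne_nil hb
    exact (wp_pivotGram hσ.size hu hun (hgram.2 hb)).mono (by omega) fun _ _ h => h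
  · have hrank := (hF.reg (x := Reg.rank) rfl).trans hgram.1
    exact ⟨by simp [NExp.eval, hrank], fun _ => hτ⟩

def gramCost (n : ℕ) : ℕ := 2 + loopCost n (10 + addPivotCost n)

theorem wp_gram (hσ : AtBasis n d e r v c lab σ) :
    WP gram (gramCost n) (HasGram n r (pivots lab c v)) σ := by
  refine (WP.seq (k' := loopCost v (10 + addPivotCost n)) (R := fun τ => τ.natReg Reg.rank = 0)
    (WP.setNat le_rfl rfl) fun τ hF hτ => ?_).mono
      (Nat.add_le_add_left (loopCost_mono hσ.vertex_lt.le le_rfl) 2) fun τ _ h => h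
  have hin := hσ.frame hF rfl
  refine WP.forLt (fun u => HasGram n r (pivots lab c u)) hin.vertex rfl rfl
    (by simpa [HasGram, pivots] using hτ) fun u hu υ hF' hυ hI => ?_
  have hin' := hin.frame hF' rfl
  refine WP.ite le_rfl (fun hb => ?_) fun hb => WP.skip (Nat.le_add_left 1 _) ?_ <;>
    rw [sameLabel_holds hin' hυ] at hb <;> rw [pivots_succ]
  · rw [if_pos hb]
    exact wp_addPivot hin'.toInput hυ (hu.trans hin'.vertex_lt) hI
  · rwa [if_neg hb]

/-- The residual of the entry in the registers `a` and `b` vanishes. -/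
def residualZero (a b : ℕ) : Test :=
  .and (.realLe (.read RealArr.gram (ix Reg.size a b)) (.cast (.const 0)))
    (.realLe (.cast (.const 0)) (.read RealArr.gram (ix Reg.size a b)))

variable {a b : ℕ}

theorem residualZero_holds (hsize : σ.natReg Reg.size = n) (ha : σ.natReg a = x)
    (hb : σ.natReg b = y) :
    (residualZero a b).Holds σ ↔ σ.realArr RealArr.gram (x * n + y) = 0 := by
  simp only [Reg.size] at hsize
  simp [residualZero, Test.Holds, RExp.eval, NExp.eval, hsize, ha, hb, le_antisymm_iff]

theorem residualZero_cost_le (hsize : σ.natReg Reg.size = n) (ha : σ.natReg a = x) (hx : x < n) :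
    (residualZero a b).cost σ ≤ 4 * n + 19 := by
  have hix := ix_cost_le Reg.size a b σ
  simp only [residualZero, Test.cost, RExp.cost, NExp.cost]
  omega

/-- Set `Reg.fail` if the element in `Reg.vertex` has an entry that contradicts its dependence on
the basis in `Reg.basis`. -/
def conflictTest : Prog :=
  .forLt Reg.col Reg.size (.ite (unspecified Reg.vertex Reg.col) .skip
    (.seq (joinTest sameLabel Reg.col)
      (.ite (.and (.natLe (.reg Reg.unjoined) (.const 0)) (.not (residualZero Reg.vertex Reg.col)))
        (.setNat Reg.fail (.const 1)) .skip)))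

theorem wp_pivotsJoinTest (hσ : AtBasis n d e r v c lab σ) (hy : σ.natReg Reg.col = y)
    (hyn : y < n) : WP (joinTest sameLabel Reg.col) (2 + loopCost n (2 * n + 20))
      (fun τ => τ.natReg Reg.unjoined = 0 ↔ ∀ u ∈ pivots lab c v, Spec n e u y) σ :=
  (wp_joinTest (p := fun u => lab u = c) (C := 9) hσ.toInput hσ.vertex hσ.vertex_lt hy hyn rfl
    fun _ _ _ hF hτ => ⟨sameLabel_holds (hσ.frame hF rfl) hτ, le_rfl⟩).mono
      (Nat.add_le_add_left (loopCost_mono le_rfl (by omega)) 2) fun τ _ h => by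
        simpa only [mem_pivots, and_imp] using h

def conflictCost (n : ℕ) : ℕ :=
  loopCost n (2 * n + 8 + (2 + loopCost n (2 * n + 20) + (4 * n + 26 + 2)))

theorem wp_conflictTest (hσ : AtBasis n d e r v c lab σ) (hgram : ∀ y < n,
      σ.realArr RealArr.gram (v * n + y) = residual (Val n r) (pivots lab c v) v y) :
    WP conflictTest (conflictCost n) (fun τ => τ.natReg Reg.fail = 0 ↔
      σ.natReg Reg.fail = 0 ∧ ¬ Conflict (Spec n e) (Val n r) lab c v) σ := by
  refine (WP.forLt_flag (f := Reg.fail) (fun y => ¬ (Spec n e v y ∧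
    (∀ u ∈ pivots lab c v, Spec n e u y) ∧ residual (Val n r) (pivots lab c v) v y ≠ 0))
    hσ.size rfl rfl (by decide) fun y hy υ hF hυ => ?_).mono le_rfl fun υ _ hυ => ?_
  · have hin := hσ.frame hF rfl
    have hcost := unspecified_cost_le (b := Reg.col) hin.toInput hin.vertex hin.vertex_lt
    refine WP.ite (c := 2 * n + 8) (by omega) (fun hb => WP.skip (by omega) ?_) fun hb => ?_ <;>
      rw [unspecified_holds hin.toInput hin.vertex hin.vertex_lt hυ hy] at hb
    · exact (and_iff_left fun h => hb h.1).symm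
    refine WP.seq (wp_pivotsJoinTest hin hυ hy) fun φ hFφ hφ => ?_
    have hin' := hin.frame hFφ rfl
    have hcol : φ.natReg Reg.col = y := (hFφ.reg rfl).trans hυ
    have hfail := hFφ.reg (x := Reg.fail) rfl
    have hgram' : φ.realArr RealArr.gram (v * n + y) = _ :=
      (congrFun ((hFφ.realArr rfl).trans (hF.realArr rfl)) _).trans (hgram y hy)
    have hcost' := residualZero_cost_le (b := Reg.col) hin'.size hin'.vertex hin'.vertex_lt
    refine WP.ite (c := 4 * n + 26) (by simp only [Test.cost, NExp.cost]; omega)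
      (fun hb' => WP.setNat le_rfl ?_) fun hb' => WP.skip (by omega) ?_ <;>
      simp only [Test.Holds, NExp.eval, nonpos_iff_eq_zero, hφ, hgram',
        residualZero_holds hin'.size hin'.vertex hcol] at hb'
    · simp only [State.setNat_natReg, if_true, NExp.eval, one_ne_zero, false_iff]
      exact fun h => h.2 ⟨not_not.1 hb, hb'⟩
    · exact hfail ▸ (and_iff_left fun h => hb' h.2).symm
  · rw [hυ, Conflict, not_exists]
    exact and_congr_right fun _ => ⟨fun h y hy => h y hy.1.2.1 hy, fun h y _ => h y⟩

end Basis

section Distribution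

variable {n d K v i : ℕ} {e : ℕ → ℕ} {r : ℕ → ℝ} {lab : ℕ → ℕ} {σ τ : State}

/-- The state of the search for the label of `v` after `i` bases, if the labels were `lab` and
`Reg.fail` was `f` before the search. -/
structure Searched (n d : ℕ) (e : ℕ → ℕ) (r : ℕ → ℝ) (lab : ℕ → ℕ) (f v i : ℕ) (σ : State) :
    Prop where
  label : ∀ u < v, lab u = σ.natArr Arr.label u
  firstFit : FirstFit (Val n r) i (σ.natArr Arr.label) v
  fail : σ.natReg Reg.fail = 0 ↔
    f = 0 ∧ Consistent (Spec n e) (Val n r) d i (σ.natArr Arr.label) v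

/-- The element in `Reg.vertex` depends on the basis whose residuals have been computed. -/
def dependsTest : Test :=
  .and (.natLe (.const 1) (.reg Reg.rank)) (residualZero Reg.vertex Reg.vertex)

theorem dependsTest_holds (hσ : AtBasis n d e r v i lab σ)
    (hgram : HasGram n r (pivots lab i v) σ) :
    dependsTest.Holds σ ↔ DependsOn (Val n r) lab i v := by
  simp only [dependsTest, Test.Holds, NExp.eval, hgram.1, Nat.one_le_iff_ne_zero, DependsOn, Ne,
    List.length_eq_zero_iff, residualZero_holds hσ.size hσ.vertex hσ.vertex]
  exact and_congr_right fun h => by rw [hgram.2 h v hσ.vertex_lt v hσ.vertex_lt]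

/-- Try to add the element in `Reg.vertex` to the basis in `Reg.basis`. The label is increased if
this is impossible. -/
def tryBasis : Prog :=
  .ite (.natLe (.reg Reg.basis) (.read Arr.label (.reg Reg.vertex)))
    (.seq gram (.ite dependsTest
      (.seq conflictTest (.writeNat Arr.label (.reg Reg.vertex) (.add (.reg Reg.basis) (.const 1))))
      (.ite (.natLe (.add (.reg Reg.dim) (.const 1)) (.reg Reg.rank))
        (.setNat Reg.fail (.const 1)) .skip)))
    .skip

theorem wp_rejectBasis {f : ℕ} (hσ : AtBasis n d e r v i (σ.natArr Arr.label) σ)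
    (hS : Searched n d e r lab f v i σ) (hi : σ.natArr Arr.label v = i)
    (hgram : HasGram n r (pivots (σ.natArr Arr.label) i v) σ)
    (hdep : DependsOn (Val n r) (σ.natArr Arr.label) i v) :
    WP (.seq conflictTest
        (.writeNat Arr.label (.reg Reg.vertex) (.add (.reg Reg.basis) (.const 1))))
      (conflictCost n + 5) (Searched n d e r lab f v (i + 1)) σ := by
  refine WP.seq (wp_conflictTest hσ fun y => hgram.2 hdep.1 v hσ.vertex_lt y)
    fun τ hF hτ => WP.writeNat le_rfl ?_
  have hin := hσ.frame hF rfl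
  have harr : (τ.writeNat Arr.label v (i + 1)).natArr Arr.label =
      Function.update (σ.natArr Arr.label) v (i + 1) := by
    rw [State.writeNat_natArr_self, hin.label]
  simp only [NExp.eval, hin.vertex, hin.basis]
  refine ⟨fun u hu => ?_, ?_, ?_⟩
  · rw [harr, Function.update_of_ne hu.ne, hS.label u hu]
  · rw [harr]
    exact hS.firstFit.update_succ hi hdep
  · rw [harr, consistent_update_succ hi, State.writeNat_natReg, hτ, hS.fail, and_assoc]

theorem wp_acceptBasis {f : ℕ} (hσ : AtBasis n d e r v i (σ.natArr Arr.label) σ)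
    (hS : Searched n d e r lab f v i σ) (hi : σ.natArr Arr.label v = i)
    (hgram : HasGram n r (pivots (σ.natArr Arr.label) i v) σ)
    (hdep : ¬ DependsOn (Val n r) (σ.natArr Arr.label) i v) :
    WP (.ite (.natLe (.add (.reg Reg.dim) (.const 1)) (.reg Reg.rank))
        (.setNat Reg.fail (.const 1)) .skip)
      8 (Searched n d e r lab f v (i + 1)) σ := by
  have hfirst := hS.firstFit.succ_of_not_dependsOn hi hdep
  have hdim := hσ.dim
  refine WP.ite (c := 6) (k := 2) le_rfl (fun hb => WP.setNat le_rfl ⟨hS.label, hfirst, ?_⟩)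
      fun hb => WP.skip (by omega) ⟨hS.label, hfirst, ?_⟩ <;>
    simp only [Test.Holds, NExp.eval, hgram.1, hdim, Nat.succ_le_iff, not_lt] at hb
  · simp only [State.setNat_natReg, State.setNat_natArr, if_true, NExp.eval, one_ne_zero,
      false_iff, consistent_succ_of_eq hi]
    exact fun h => h.2.2.not_gt hb
  · rw [consistent_succ_of_eq hi, hS.fail, and_iff_left hb]

def tryCost (n : ℕ) : ℕ := 5 + (gramCost n + (4 * n + 24 + (conflictCost n + 8)))

theorem wp_tryBasis {f : ℕ} (hσ : AtBasis n d e r v i (σ.natArr Arr.label) σ)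
    (hS : Searched n d e r lab f v i σ) :
    WP tryBasis (tryCost n) (Searched n d e r lab f v (i + 1)) σ := by
  refine WP.ite le_rfl (fun hb => ?_) fun hb => WP.skip (Nat.le_add_left 1 _) ?_ <;>
    simp only [Test.Holds, NExp.eval, hσ.vertex, hσ.basis, not_le] at hb
  · refine WP.seq (wp_gram hσ) fun τ hF hτ => ?_
    have hlabel : τ.natArr Arr.label = σ.natArr Arr.label := hF.natArr rfl
    have hfail : τ.natReg Reg.fail = σ.natReg Reg.fail := hF.reg rfl
    have hin := hσ.frame hF rfl
    rw [← hlabel] at hin hτ hb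
    have hS' : Searched n d e r lab f v i τ :=
      ⟨hlabel ▸ hS.label, hlabel ▸ hS.firstFit, hlabel ▸ hfail ▸ hS.fail⟩
    have hi : τ.natArr Arr.label v = i := hS'.firstFit.le.antisymm hb
    have hcost := residualZero_cost_le (b := Reg.vertex) hin.size hin.vertex hin.vertex_lt
    refine WP.ite (by simp only [dependsTest, Test.cost, NExp.cost]; omega) (fun hdep => ?_)
      fun hdep => ?_ <;> rw [dependsTest_holds hin hτ] at hdep
    · exact (wp_rejectBasis hin hS' hi hτ hdep).mono (by omega) fun _ _ h => h
    · exact (wp_acceptBasis hin hS' hi hτ hdep).mono (by omega) fun _ _ h => h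
  · exact ⟨hS.label, hS.firstFit.succ_of_lt hb, by rw [hS.fail, consistent_succ_of_lt hb]⟩

/-- The elements below `v` have been distributed over `K` bases, and `Reg.fail` tells whether
a test has failed. -/
structure Distributed (n d : ℕ) (e : ℕ → ℕ) (r : ℕ → ℝ) (K v : ℕ) (σ : State) : Prop where
  labelled : ∀ w < v, Labelled (Spec n e) (Val n r) K (σ.natArr Arr.label) w
  fail : σ.natReg Reg.fail = 0 ↔
    ∀ w < v, Consistent (Spec n e) (Val n r) d K (σ.natArr Arr.label) w

theorem Distributed.succ (h : Distributed n d e r K v σ)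
    (hlabel : ∀ u < v, σ.natArr Arr.label u = τ.natArr Arr.label u)
    (hlabelled : Labelled (Spec n e) (Val n r) K (τ.natArr Arr.label) v)
    (hfail : τ.natReg Reg.fail = 0 ↔ σ.natReg Reg.fail = 0 ∧
      Consistent (Spec n e) (Val n r) d K (τ.natArr Arr.label) v) :
    Distributed n d e r K (v + 1) τ where
  labelled := Nat.forall_lt_succ_right.2 ⟨fun w hw =>
    (labelled_congr fun u hu => hlabel u (hu.trans_lt hw)).1 (h.labelled w hw), hlabelled⟩
  fail := by
    rw [hfail, h.fail, Nat.forall_lt_succ_right]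
    exact and_congr_left fun _ => forall₂_congr fun w hw =>
      consistent_congr fun u hu => hlabel u (hu.trans_lt hw)

/-- Find the label of the element in `Reg.vertex`. -/
def vertexStep : Prog :=
  .seq (joinTest (.natLe (.add (.read Arr.label (.reg Reg.pivot)) (.const 1)) (.reg Reg.bases))
      Reg.vertex)
    (.ite (.natLe (.reg Reg.unjoined) (.const 0))
      (.seq (.writeNat Arr.label (.reg Reg.vertex) (.const 0))
        (.forLt Reg.basis Reg.bases tryBasis))
      (.writeNat Arr.label (.reg Reg.vertex) (.add (.reg Reg.bases) (.const 1))))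

theorem wp_search (hσ : Input n d e r σ) (hv : σ.natReg Reg.vertex = v) (hvn : v < n)
    (hK : σ.natReg Reg.bases = K) (hlab : lab = σ.natArr Arr.label) :
    WP (.seq (.writeNat Arr.label (.reg Reg.vertex) (.const 0))
        (.forLt Reg.basis Reg.bases tryBasis))
      (3 + loopCost K (tryCost n)) (Searched n d e r lab (σ.natReg Reg.fail) v K) σ := by
  subst hlab
  refine WP.seq (R := fun τ => τ.natReg Reg.fail = σ.natReg Reg.fail ∧
      τ.natArr Arr.label = Function.update (σ.natArr Arr.label) v 0)
    (WP.writeNat le_rfl ⟨rfl, ?_⟩) fun τ hF hτ => ?_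
  · rw [State.writeNat_natArr_self, NExp.eval, NExp.eval, hv]
  have hin := hσ.frame hF rfl
  refine WP.forLt (Searched n d e r (σ.natArr Arr.label) (σ.natReg Reg.fail) v)
    ((hF.reg rfl).trans hK) rfl rfl ⟨fun u hu => ?_, ?_, ?_⟩ fun i _ υ hF' hυ hI => ?_
  · rw [State.setNat_natArr, hτ.2, Function.update_of_ne hu.ne]
  · simp [firstFit_iff, hτ.2]
  · simp only [State.setNat_natReg, State.setNat_natArr, hτ, consistent_iff]
    simp
  · have hvertex : υ.natReg Reg.vertex = v := (hF'.reg rfl).trans ((hF.reg rfl).trans hv)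
    exact (wp_tryBasis ⟨hin.frame hF' rfl, hvertex, hvn, hυ, rfl⟩ hI).mono le_rfl
      fun φ _ hφ => ⟨hφ.label, hφ.firstFit, by simpa using hφ.fail⟩

theorem wp_joined (hσ : Input n d e r σ) (hv : σ.natReg Reg.vertex = v) (hvn : v < n)
    (hK : σ.natReg Reg.bases = K) :
    WP (joinTest (.natLe (.add (.read Arr.label (.reg Reg.pivot)) (.const 1)) (.reg Reg.bases))
        Reg.vertex) (2 + loopCost n (2 * n + 17))
      (fun τ => τ.natReg Reg.unjoined = 0 ↔ Joined (Spec n e) K (σ.natArr Arr.label) v) σ :=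
  (wp_joinTest (p := fun u => σ.natArr Arr.label u < K) (C := 6) hσ hv hvn hv hvn rfl
    fun u _ τ hF hτ => ⟨by
      have hlabel := hF.natArr (a := Arr.label) rfl
      have hbases := (hF.reg (x := Reg.bases) rfl).trans hK
      simp only [Test.Holds, NExp.eval, hτ, hlabel, hbases, Nat.add_one_le_iff], le_rfl⟩).mono
    (Nat.add_le_add_left (loopCost_mono le_rfl (by omega)) 2) fun τ _ h => h

def vertexCost (n : ℕ) : ℕ :=
  2 + loopCost n (2 * n + 17) + (4 + (3 + loopCost (n + 1) (tryCost n)))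

theorem wp_vertexStep (hσ : Input n d e r σ) (hv : σ.natReg Reg.vertex = v) (hvn : v < n)
    (hK : σ.natReg Reg.bases = K) (hKn : K ≤ n + 1) (hI : Distributed n d e r K v σ) :
    WP vertexStep (vertexCost n) (Distributed n d e r K (v + 1)) σ := by
  refine WP.seq (wp_joined hσ hv hvn hK) fun τ hF hτ => ?_
  have hin := hσ.frame hF rfl
  have hbases : τ.natReg Reg.bases = K := (hF.reg rfl).trans hK
  have hvertex : τ.natReg Reg.vertex = v := (hF.reg rfl).trans hv
  have hlabel : τ.natArr Arr.label = σ.natArr Arr.label := hF.natArr rfl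
  have hfail : τ.natReg Reg.fail = σ.natReg Reg.fail := hF.reg rfl
  refine WP.ite le_rfl (fun hb => ?_)
    fun hb => WP.writeNat (by simp only [NExp.cost, loopCost]; omega) ?_ <;>
    simp only [Test.Holds, NExp.eval, nonpos_iff_eq_zero, hτ] at hb
  · refine (wp_search hin hvertex hvn hbases hlabel.symm).mono
      (Nat.add_le_add_left (loopCost_mono hKn le_rfl) 3) fun υ _ hυ => ?_
    exact hI.succ hυ.label (.inl ⟨(joined_congr hυ.label).1 hb, hυ.firstFit⟩) (hfail ▸ hυ.fail)
  · simp only [NExp.eval, hvertex, hbases]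
    have hself : (τ.writeNat Arr.label v (K + 1)).natArr Arr.label v = K + 1 := by simp
    have hother : ∀ u < v, σ.natArr Arr.label u =
        (τ.writeNat Arr.label v (K + 1)).natArr Arr.label u := fun u hu => by
      simp [hu.ne, ← hlabel]
    refine hI.succ hother (.inr ⟨mt (joined_congr hother).2 hb, hself⟩) ?_
    rw [State.writeNat_natReg, hfail, consistent_iff, hself]
    simp

end Distribution

section Kernel

/-- The first `m` values of `s` are the elements below `v` that satisfy `p`, in increasing
order. -/
structure Lists (p : ℕ → Prop) (v m : ℕ) (s : ℕ → ℕ) : Prop where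
  strictMonoOn : StrictMonoOn s (Set.Iio m)
  mem_iff : ∀ u, (∃ k < m, s k = u) ↔ u < v ∧ p u

namespace Lists

variable {p : ℕ → Prop} {v m : ℕ} {s : ℕ → ℕ}

theorem zero (p : ℕ → Prop) (s : ℕ → ℕ) : Lists p 0 0 s := ⟨by simp [StrictMonoOn], by simp⟩

theorem skip (h : Lists p v m s) (hv : ¬ p v) : Lists p (v + 1) m s where
  strictMonoOn := h.strictMonoOn
  mem_iff u := by
    rw [h.mem_iff, Nat.lt_succ_iff_lt_or_eq]
    exact ⟨fun hu => ⟨.inl hu.1, hu.2⟩,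
      fun hu => ⟨hu.1.resolve_right fun he => hv (he ▸ hu.2), hu.2⟩⟩

theorem push (h : Lists p v m s) (hv : p v) : Lists p (v + 1) (m + 1) (Function.update s m v) where
  strictMonoOn := by
    intro i hi j hj hij
    rw [Set.mem_Iio] at hi hj
    have him : i < m := by omega
    rw [Function.update_of_ne him.ne]
    rcases Nat.lt_succ_iff_lt_or_eq.1 hj with hjm | rfl
    · rw [Function.update_of_ne hjm.ne]
      exact h.strictMonoOn him hjm hij
    · rw [Function.update_self]
      exact ((h.mem_iff _).1 ⟨i, him, rfl⟩).1
  mem_iff u := by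
    have hother : (∃ k < m, Function.update s m v k = u) ↔ ∃ k < m, s k = u :=
      exists_congr fun k => and_congr_right fun hk => by rw [Function.update_of_ne hk.ne]
    rw [Nat.exists_lt_succ_right, hother, h.mem_iff, Function.update_self, Nat.lt_succ_iff_lt_or_eq,
      or_and_right]
    exact or_congr_right ⟨fun hu => ⟨hu.symm, hu ▸ hv⟩, fun hu => hu.1.symm⟩

theorem lt (h : Lists p v m s) {k : ℕ} (hk : k < m) : s k < v := ((h.mem_iff _).1 ⟨k, hk, rfl⟩).1

theorem card_eq [DecidablePred p] (h : Lists p v m s) : #{u ∈ range v | p u} = m := by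
  have himage : (range m).image s = {u ∈ range v | p u} := by
    ext u
    simp only [mem_image, mem_range, h.mem_iff, mem_filter]
  rw [← himage, card_image_of_injOn (by simpa using h.strictMonoOn.injOn), card_range]

theorem le (h : Lists p v m s) : m ≤ v := by
  classical
  exact h.card_eq ▸ (card_filter_le _ _).trans (card_range v).le

theorem pos (h : Lists p v m s) {u : ℕ} (hu : u < v) (hp : p u) : 0 < m := by
  obtain ⟨k, hk, -⟩ := (h.mem_iff u).2 ⟨hu, hp⟩
  exact Nat.zero_lt_of_lt hk

/-- The list as an embedding. -/
def embedding (h : Lists p v m s) : Fin m ↪o Fin v :=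
  OrderEmbedding.ofStrictMono (fun k => ⟨s k, h.lt k.2⟩) fun i j hij => h.strictMonoOn i.2 j.2 hij

theorem coe_embedding (h : Lists p v m s) (k : Fin m) : (h.embedding k : ℕ) = s k := rfl

end Lists

/-- List the elements of the kernel, which are those whose label is not `Reg.bases`. -/
def collect : Prog :=
  .seq (.setNat Reg.outSize (.const 0)) (.forLt Reg.vertex Reg.size
    (.ite (.and (.natLe (.read Arr.label (.reg Reg.vertex)) (.reg Reg.bases))
        (.natLe (.reg Reg.bases) (.read Arr.label (.reg Reg.vertex))))
      .skip
      (.seq (.writeNat Arr.kernel (.reg Reg.outSize) (.reg Reg.vertex)) (.incr Reg.outSize))))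

def collectCost (n : ℕ) : ℕ := 2 + loopCost n 17

variable {n d m K : ℕ} {e s lab : ℕ → ℕ} {r : ℕ → ℝ} {σ τ : State}

theorem wp_collect (hσ : Input n d e r σ) (hK : σ.natReg Reg.bases = K)
    (hlab : σ.natArr Arr.label = lab) : WP collect (collectCost n)
      (fun τ => Lists (lab · ≠ K) n (τ.natReg Reg.outSize) (τ.natArr Arr.kernel)) σ := by
  refine WP.seq (R := fun τ => τ.natReg Reg.outSize = 0) (WP.setNat le_rfl rfl) fun τ hF hτ => ?_
  refine WP.forLt (fun v τ => Lists (lab · ≠ K) v (τ.natReg Reg.outSize) (τ.natArr Arr.kernel))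
    (hσ.frame hF rfl).size rfl rfl ?_ fun v _ υ hF' hυ hI => ?_
  · simpa [hτ] using Lists.zero _ _
  have hbases : υ.natReg Reg.bases = K := (hF'.reg rfl).trans ((hF.reg rfl).trans hK)
  have hlabel : υ.natArr Arr.label = lab := (hF'.natArr rfl).trans ((hF.natArr rfl).trans hlab)
  refine WP.ite (c := 10) (k := 7) le_rfl (fun hb => WP.skip (by omega) ?_) fun hb => ?_ <;>
    simp only [Test.Holds, NExp.eval, hυ, hbases, hlabel, ← le_antisymm_iff] at hb
  · exact hI.skip (not_not.2 hb)
  · refine WP.seq (k := 3) (k' := 4) (R := fun φ => φ.natArr Arr.kernel =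
        Function.update (υ.natArr Arr.kernel) (υ.natReg Reg.outSize) v)
      (WP.writeNat le_rfl ?_) fun φ hF'' hφ => WP.setNat le_rfl ?_
    · rw [State.writeNat_natArr_self, NExp.eval, NExp.eval, hυ]
    · have hout : φ.natReg Reg.outSize = υ.natReg Reg.outSize := hF''.reg rfl
      simpa [NExp.eval, hout, hφ] using hI.push hb

/-- The index of the entry of the input that belongs to the entry in `Reg.row` and `Reg.col` of
the output. -/
def kernelIx : NExp :=
  .add (.mul (.read Arr.kernel (.reg Reg.row)) (.reg Reg.size)) (.read Arr.kernel (.reg Reg.col))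

/-- Write the principal submatrix on the kernel. -/
def output : Prog :=
  .seq (fillNat Arr.outPattern Reg.outSize (.read Arr.pattern kernelIx))
    (.seq (fillReal RealArr.outValues Reg.outSize (.read RealArr.values kernelIx))
      (.seq (.setNat Reg.outDim (.reg Reg.dim)) (.setNat Reg.verdict (.const 2))))

/-- The output is the principal submatrix of the input on the first `m` values of `s`. -/
structure Output (n d m : ℕ) (e s : ℕ → ℕ) (r : ℕ → ℝ) (τ : State) : Prop where
  size : τ.natReg Reg.outSize = m
  dim : τ.natReg Reg.outDim = d
  pattern : ∀ x < m, ∀ y < m, τ.natArr Arr.outPattern (x * m + y) = e (s x * n + s y)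
  values : ∀ x < m, ∀ y < m, τ.realArr RealArr.outValues (x * m + y) = r (s x * n + s y)

def outputCost (n : ℕ) : ℕ := fillCost n (2 * n + 8) + (fillCost n (2 * n + 8) + (2 + 2))

theorem kernelIx_eval (hσ : Input n d e r σ) (hs : σ.natArr Arr.kernel = s) :
    kernelIx.eval σ = s (σ.natReg Reg.row) * n + s (σ.natReg Reg.col) := by
  simp only [kernelIx, NExp.eval, hσ.size, hs]

theorem kernelIx_cost_le (hσ : Input n d e r σ) (hs : σ.natArr Arr.kernel = s)
    (hrow : s (σ.natReg Reg.row) < n) : kernelIx.cost σ ≤ 2 * n + 7 := by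
  have hrow' := size_le_self (s (σ.natReg Reg.row))
  have hn := size_le_self n
  simp only [kernelIx, NExp.cost, NExp.eval, hσ.size, hs]
  omega

theorem wp_output (hσ : Input n d e r σ) (hm : σ.natReg Reg.outSize = m)
    (hs : σ.natArr Arr.kernel = s) (hmn : m ≤ n) (hsn : ∀ k < m, s k < n) :
    WP output (outputCost n) (fun τ => verdict τ = 2 ∧ Output n d m e s r τ) σ := by
  have hfill : fillCost m (2 * n + 8) ≤ fillCost n (2 * n + 8) :=
    loopCost_mono hmn (loopCost_mono hmn (by omega))
  refine (WP.seq (wp_fillNat (C := 2 * n + 8) (fun x y => e (s x * n + s y)) hm rfl ?_)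
    fun υ hF hpattern => WP.seq (wp_fillReal (C := 2 * n + 8) (fun x y => r (s x * n + s y))
      ((hF.reg rfl).trans hm) rfl ?_) fun φ hF' hvalues => ?_).mono
    (Nat.add_le_add hfill (Nat.add_le_add_right hfill _)) fun τ _ h => h
  · intro x hx y _ τ hF hrow hcol
    have hin := hσ.frame hF rfl
    have hkernel : τ.natArr Arr.kernel = s := (hF.natArr rfl).trans hs
    have hcost := kernelIx_cost_le hin hkernel (by rw [hrow]; exact hsn x hx)
    exact ⟨by rw [NExp.eval, kernelIx_eval hin hkernel, hrow, hcol, hin.pattern],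
      Nat.succ_le_succ hcost⟩
  · intro x hx y _ τ hF' hrow hcol
    have hin := (hσ.frame hF rfl).frame hF' rfl
    have hkernel : τ.natArr Arr.kernel = s := (hF'.natArr rfl).trans ((hF.natArr rfl).trans hs)
    have hcost := kernelIx_cost_le hin hkernel (by rw [hrow]; exact hsn x hx)
    exact ⟨by rw [RExp.eval, kernelIx_eval hin hkernel, hrow, hcol, hin.values],
      Nat.succ_le_succ hcost⟩
  · have hdim := (hF'.reg (x := Reg.dim) rfl).trans ((hF.reg rfl).trans hσ.dim)
    refine WP.seq (R := fun τ => τ.natReg Reg.outDim = d) (WP.setNat le_rfl (by simpa [NExp.eval]))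
      fun τ hF'' hτ => WP.setNat le_rfl ⟨by simp [RealRAM.verdict, NExp.eval], ?_, ?_, ?_, ?_⟩
    · simpa using (hF''.reg rfl).trans ((hF'.reg rfl).trans ((hF.reg rfl).trans hm))
    · simpa using hτ
    · simpa [hF''.natArr (a := Arr.outPattern) rfl, hF'.natArr (a := Arr.outPattern) rfl]
        using hpattern
    · simpa [hF''.realArr (a := RealArr.outValues) rfl] using hvalues

/-- Distribute the elements over the bases. -/
def distribute : Prog :=
  .seq maxRow (.seq (.setNat Reg.fail (.const 0)) (.forLt Reg.vertex Reg.size vertexStep))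

def distributeCost (n : ℕ) : ℕ := maxRowCost n + (2 + loopCost n (vertexCost n))

theorem wp_distribute (hσ : Input n d e r σ) : WP distribute (distributeCost n) (fun τ =>
    NumBases n e (τ.natReg Reg.bases) ∧ Distributed n d e r (τ.natReg Reg.bases) n τ) σ := by
  refine WP.seq (wp_maxRow hσ) fun τ hF hK => ?_
  have hKn : τ.natReg Reg.bases ≤ n + 1 := hK.le n fun x _ =>
    (card_filter_le _ _).trans (card_range n).le
  refine WP.seq (R := fun υ => υ.natReg Reg.fail = 0) (WP.setNat le_rfl rfl) fun υ hF' hυ => ?_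
  have hin := (hσ.frame hF rfl).frame hF' rfl
  rw [← hF'.reg (x := Reg.bases) rfl] at hK hKn
  refine (WP.forLt (Distributed n d e r (υ.natReg Reg.bases)) hin.size rfl rfl
    ⟨by simp, by simpa⟩ fun v hv φ hF'' hφ hI =>
      (wp_vertexStep (hin.frame hF'' rfl) hφ hv (hF''.reg rfl) hKn hI).mono le_rfl
        fun ψ _ hψ => ⟨hψ.labelled, by simpa using hψ.fail⟩).mono le_rfl fun φ hF'' hφ => ?_
  rw [hF''.reg rfl]
  exact ⟨hK, hφ⟩

/-- Reject the instance if a test has failed, and reduce it to the kernel otherwise. -/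
def report : Prog :=
  .ite (.natLe (.reg Reg.fail) (.const 0)) (.seq collect output) (.setNat Reg.verdict (.const 0))

def reportCost (n : ℕ) : ℕ := 4 + (collectCost n + outputCost n)

theorem wp_report (hσ : Input n d e r σ) (hK : σ.natReg Reg.bases = K)
    (hlab : σ.natArr Arr.label = lab) : WP report (reportCost n) (fun τ =>
      verdict τ = 0 ∧ σ.natReg Reg.fail ≠ 0 ∨ verdict τ = 2 ∧ σ.natReg Reg.fail = 0 ∧
        ∃ m s, Lists (lab · ≠ K) n m s ∧ Output n d m e s r τ) σ := by
  refine WP.ite le_rfl (fun hb => ?_)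
    fun hb => WP.setNat (by simp only [NExp.cost, collectCost]; omega) (.inl ⟨?_, ?_⟩)
  · refine WP.seq (wp_collect hσ hK hlab) fun τ hF hτ => ?_
    refine (wp_output (hσ.frame hF rfl) rfl rfl hτ.le fun k => hτ.lt).mono le_rfl fun υ _ hυ =>
      .inr ⟨hυ.1, Nat.le_zero.1 hb, _, _, hτ, hυ.2⟩
  · simp [verdict, NExp.eval]
  · simpa [Test.Holds, NExp.eval] using hb

end Kernel

section Kernelize

/-- Decide the instance or reduce it to the kernel. -/
def kernelize : Prog := .seq distribute report

def kernelizeCost (n : ℕ) : ℕ := distributeCost n + reportCost n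

variable {n d : ℕ} {e : ℕ → ℕ} {r : ℕ → ℝ} {σ : State}

theorem wp_kernelize (hσ : Input n d e r σ) : WP kernelize (kernelizeCost n) (fun τ =>
    ∃ K lab, NumBases n e K ∧ (∀ w < n, Labelled (Spec n e) (Val n r) K lab w) ∧
      (verdict τ = 0 ∧ (¬ ∀ w < n, Consistent (Spec n e) (Val n r) d K lab w) ∨
        verdict τ = 2 ∧ (∀ w < n, Consistent (Spec n e) (Val n r) d K lab w) ∧
          ∃ m s, Lists (lab · ≠ K) n m s ∧ Output n d m e s r τ)) σ := by
  refine WP.seq (wp_distribute hσ) fun τ hF ⟨hK, hdist⟩ =>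
    (wp_report (hσ.frame hF rfl) rfl rfl).mono le_rfl fun υ _ hυ =>
      ⟨_, _, hK, hdist.labelled, hυ.imp (fun h => ⟨h.1, ?_⟩) fun h => ⟨h.1, ?_, h.2.2⟩⟩
  · exact mt hdist.fail.2 h.2
  · exact hdist.fail.1 h.2.1

/-- `f` is given by a polynomial with natural coefficients. -/
def IsPoly (f : ℕ → ℕ) : Prop := ∃ T : Polynomial ℕ, ∀ n, T.eval n = f n

theorem IsPoly.const (c : ℕ) : IsPoly fun _ => c := ⟨.C c, fun _ => Polynomial.eval_C⟩

theorem IsPoly.id : IsPoly fun n => n := ⟨.X, fun _ => Polynomial.eval_X⟩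

theorem IsPoly.add {f g : ℕ → ℕ} (hf : IsPoly f) (hg : IsPoly g) : IsPoly fun n => f n + g n := by
  obtain ⟨S, hS⟩ := hf
  obtain ⟨T, hT⟩ := hg
  exact ⟨S + T, fun n => by rw [Polynomial.eval_add, hS, hT]⟩

theorem IsPoly.mul {f g : ℕ → ℕ} (hf : IsPoly f) (hg : IsPoly g) : IsPoly fun n => f n * g n := by
  obtain ⟨S, hS⟩ := hf
  obtain ⟨T, hT⟩ := hg
  exact ⟨S * T, fun n => by rw [Polynomial.eval_mul, hS, hT]⟩

theorem isPoly_kernelizeCost : IsPoly kernelizeCost := by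
  unfold kernelizeCost distributeCost reportCost maxRowCost vertexCost tryCost gramCost
    addPivotCost pivotGramCost conflictCost collectCost outputCost fillCost loopCost
  repeat first
    | exact IsPoly.id
    | exact IsPoly.const _
    | apply IsPoly.add
    | apply IsPoly.mul

end Kernelize

/-! ### Correctness -/

section Correctness

variable {n d m : ℕ} {M : PartialMatrix n} {σ τ : State}

theorem input_of_stores (hσ : σ.Stores 0 M d) :
    Input n d (σ.natArr 0) (σ.realArr 0) σ :=
  ⟨hσ.1, hσ.2.1, rfl, rfl⟩

theorem spec_iff (hσ : σ.Stores 0 M d) (i j : Fin n) :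
    Spec n (σ.natArr 0) i j ↔ (M.entry i j).isSome := by
  rw [Spec, (hσ.2.2 i j).1]
  split_ifs with h <;> simp [h]

theorem val_eq (hσ : σ.Stores 0 M d) {i j : Fin n} {v : ℝ} (h : M.entry i j = some v) :
    Val n (σ.realArr 0) i j = v :=
  (hσ.2.2 i j).2 v h

theorem card_unspecified_eq (hσ : σ.Stores 0 M d) (i : Fin n) :
    #{y ∈ range n | ¬ Spec n (σ.natArr 0) i y} = M.unspecified i := by
  rw [PartialMatrix.unspecified, ← card_map Fin.valEmbedding]
  congr 1
  ext y
  simp only [mem_map, mem_filter, mem_univ, true_and, Fin.valEmbedding_apply, mem_range]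
  constructor
  · rintro ⟨hy, h⟩
    exact ⟨⟨y, hy⟩, by simpa [spec_iff hσ i ⟨y, hy⟩] using h, rfl⟩
  · rintro ⟨j, hj, rfl⟩
    exact ⟨j.2, by simpa [spec_iff hσ] using hj⟩

theorem isPartialDist (hσ : σ.Stores 0 M d) :
    IsPartialDist (Set.Iio n) (Spec n (σ.natArr 0)) (Val n (σ.realArr 0)) where
  mem h := h.1
  refl {i} hi := (spec_iff hσ ⟨i, hi⟩ ⟨i, hi⟩).2 (by simp [M.diag])
  symm {i j} h := by
    rw [spec_iff hσ ⟨j, h.2.1⟩ ⟨i, h.1⟩, M.symm]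
    exact (spec_iff hσ ⟨i, h.1⟩ ⟨j, h.2.1⟩).1 h
  self {i} hi := val_eq hσ (M.diag ⟨i, hi⟩)
  comm {i j} h := by
    obtain ⟨v, hv⟩ := Option.isSome_iff_exists.1 ((spec_iff hσ ⟨i, h.1⟩ ⟨j, h.2.1⟩).1 h)
    exact (val_eq hσ hv).trans (val_eq hσ ((M.symm _ _).trans hv)).symm

theorem principal_isYes_iff (hσ : σ.Stores 0 M d) (f : Fin m ↪o Fin n) :
    (M.principal f).IsYes d ↔ ∃ p : ℕ → EuclideanSpace ℝ (Fin d),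
      Realizes (Spec n (σ.natArr 0)) (Val n (σ.realArr 0)) (Set.range fun k => (f k : ℕ)) p := by
  constructor
  · rintro ⟨D, ⟨p, hp⟩, hD⟩
    have hinj : Function.Injective fun k => (f k : ℕ) := Fin.val_injective.comp f.injective
    refine ⟨Function.extend (fun k => (f k : ℕ)) p 0, ?_⟩
    rintro _ ⟨k, rfl⟩ _ ⟨l, rfl⟩ hspec
    obtain ⟨v, hv⟩ := Option.isSome_iff_exists.1 ((spec_iff hσ (f k) (f l)).1 hspec)
    rw [hinj.extend_apply, hinj.extend_apply, ← hp, val_eq hσ hv]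
    exact (hD k l v hv).symm
  · rintro ⟨p, hp⟩
    refine ⟨fun k l => ‖p (f k) - p (f l)‖ ^ 2, ⟨fun k => p (f k), fun _ _ => rfl⟩,
      fun k l v hv => ?_⟩
    change M.entry (f k) (f l) = some v at hv
    rw [← val_eq hσ hv]
    exact (hp _ ⟨k, rfl⟩ _ ⟨l, rfl⟩ ((spec_iff hσ _ _).2 (by simp [hv]))).symm

theorem isYes_iff (hσ : σ.Stores 0 M d) : M.IsYes d ↔ ∃ p : ℕ → EuclideanSpace ℝ (Fin d),
    Realizes (Spec n (σ.natArr 0)) (Val n (σ.realArr 0)) Set.univ p := by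
  refine (principal_isYes_iff hσ (OrderIso.refl (Fin n)).toOrderEmbedding).trans
    (exists_congr fun p => ⟨fun hp i _ j _ h => ?_, fun hp i _ j _ => hp i trivial j trivial⟩)
  exact hp i ⟨⟨i, h.1⟩, rfl⟩ j ⟨⟨j, h.2.1⟩, rfl⟩ h

theorem consistent_of_isYes (hσ : σ.Stores 0 M d) {K : ℕ} {lab : ℕ → ℕ}
    (hlab : ∀ w < n, Labelled (Spec n (σ.natArr 0)) (Val n (σ.realArr 0)) K lab w)
    (hM : M.IsYes d) {w : ℕ} (hw : w < n) :
    Consistent (Spec n (σ.natArr 0)) (Val n (σ.realArr 0)) d K lab w := by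
  obtain ⟨p, hp⟩ := (isYes_iff hσ).1 hM
  exact consistent_of_realizes finrank_euclideanSpace_fin.le hp (isPartialDist hσ) hlab hw

section Kernel

variable {K : ℕ} {lab s : ℕ → ℕ}

theorem isYes_kernel_iff (hσ : σ.Stores 0 M d) (hK : NumBases n (σ.natArr 0) K)
    (hlab : ∀ w < n, Labelled (Spec n (σ.natArr 0)) (Val n (σ.realArr 0)) K lab w)
    (hcons : ∀ w < n, Consistent (Spec n (σ.natArr 0)) (Val n (σ.realArr 0)) d K lab w)
    (hL : Lists (lab · ≠ K) n m s) : (M.principal hL.embedding).IsYes d ↔ M.IsYes d := by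
  have hrange : (Set.range fun k => (hL.embedding k : ℕ)) = {u | u < n ∧ lab u ≠ K} := by
    ext u
    simpa [hL.coe_embedding, Fin.exists_iff] using hL.mem_iff u
  rw [principal_isYes_iff hσ, isYes_iff hσ, hrange]
  refine ⟨fun ⟨p, hp⟩ => ?_, fun ⟨p, hp⟩ => ⟨p, fun i _ j _ => hp i trivial j trivial⟩⟩
  exact exists_realizes_univ (isPartialDist hσ) hlab hcons hK.lt hp

theorem kernel_pos (hK : NumBases n (σ.natArr 0) K)
    (hlab : ∀ w < n, Labelled (Spec n (σ.natArr 0)) (Val n (σ.realArr 0)) K lab w)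
    (hL : Lists (lab · ≠ K) n m s) (hn : 0 < n) : 0 < m := by
  refine hL.pos hn fun h => ?_
  have hKpos : 0 < lab 0 := h ▸ Nat.zero_lt_of_lt (hK.lt 0 hn)
  exact (((hlab 0 hn).firstFit h.le).dependsOn 0 hKpos).1 rfl

theorem kernel_le {Δ : ℕ} (hΔ : ∀ i, M.unspecified i ≤ Δ) (hσ : σ.Stores 0 M d)
    (hK : NumBases n (σ.natArr 0) K)
    (hlab : ∀ w < n, Labelled (Spec n (σ.natArr 0)) (Val n (σ.realArr 0)) K lab w)
    (hcons : ∀ w < n, Consistent (Spec n (σ.natArr 0)) (Val n (σ.realArr 0)) d K lab w)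
    (hL : Lists (lab · ≠ K) n m s) : m ≤ (d + 1) * (Δ + 1) ^ 2 := by
  have hKΔ : K ≤ Δ + 1 := hK.le Δ fun x hx => (card_unspecified_eq hσ ⟨x, hx⟩).trans_le (hΔ _)
  calc m = #{u ∈ range n | lab u ≠ K} := hL.card_eq.symm
    _ ≤ (d + 1) * K ^ 2 := card_kernel_le hlab hcons hK.lt
    _ ≤ (d + 1) * (Δ + 1) ^ 2 := by gcongr

theorem stores_kernel {p : ℕ → Prop} (hσ : σ.Stores 0 M d) (hL : Lists p n m s)
    (hτ : Output n d m (σ.natArr 0) s (σ.realArr 0) τ) :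
    τ.Stores 1 (M.principal hL.embedding) d := by
  refine ⟨hτ.size, hτ.dim, fun i j => ⟨?_, fun v hv => ?_⟩⟩
  · exact (hτ.pattern i i.2 j j.2).trans (hσ.2.2 (hL.embedding i) (hL.embedding j)).1
  · exact (hτ.values i i.2 j j.2).trans (val_eq hσ hv)

end Kernel

end Correctness

end EDMC

/-- The input `(M, d)` is read from block `0` of the memory, and an output instance is left in
block `1`. -/
theorem theorem1p3 :
    ∃ (P : RealRAM.Prog) (T : Polynomial ℕ),
      ∀ (n d Δ : ℕ) (M : PartialMatrix n), (∀ i, M.unspecified i ≤ Δ) →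
        ∀ σ : RealRAM.State, σ.Stores 0 M d →
          ∃ (t : ℕ) (τ : RealRAM.State), RealRAM.Exec P σ t τ ∧ t ≤ T.eval n ∧
            ((RealRAM.verdict τ = 0 ∧ ¬ M.IsYes d) ∨
             (RealRAM.verdict τ = 1 ∧ M.IsYes d) ∨
             (RealRAM.verdict τ = 2 ∧
               ∃ (m : ℕ) (f : Fin m ↪o Fin n),
                 τ.Stores 1 (M.principal f) d ∧
                 ((M.principal f).IsYes d ↔ M.IsYes d) ∧
                 (0 < n → 0 < m) ∧
                 m ≤ (d + 1) * (Δ + 1) ^ 2)) := by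
  obtain ⟨T, hT⟩ := EDMC.isPoly_kernelizeCost
  refine ⟨EDMC.kernelize, T, fun n d Δ M hΔ σ hσ => ?_⟩
  obtain ⟨t, τ, hexec, ht, K, lab, hK, hlab, hout⟩ := EDMC.wp_kernelize (EDMC.input_of_stores hσ)
  refine ⟨t, τ, hexec, ht.trans_eq (hT n).symm, ?_⟩
  rcases hout with ⟨hverdict, hfail⟩ | ⟨hverdict, hcons, m, s, hL, hτ⟩
  · exact .inl ⟨hverdict, fun hM => hfail fun _ => EDMC.consistent_of_isYes hσ hlab hM⟩
  · exact .inr (.inr ⟨hverdict, m, hL.embedding, EDMC.stores_kernel hσ hL hτ,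
      EDMC.isYes_kernel_iff hσ hK hlab hcons hL, EDMC.kernel_pos hK hlab hL,
      EDMC.kernel_le hΔ hσ hK hlab hcons hL⟩)
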